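/- Let $k,n$ be positive integers and let $\mu$ be a partition with $|\mu|=k$. For a partition $\lambda$, let $\mathrm{SSYT}(\lambda,n)$ be the set of semistandard Young tableaux of shape $\lambda$ with labels in $\{1,\dots,n\}$, let $\mathrm{SYT}(\lambda)$ be the set of standard Young tableaux of shape $\lambda$ with labels $1,\dots,|\lambda|$, let $$s_\lambda(x_1,\dots,x_n)=\sum_{T\in \mathrm{SSYT}(\lambda,n)}x^{\mathrm{wt}(T)}$$ be the Schur polynomial, and put $$\overline{s}_\lambda(x_1,\dots,x_n)=s_\lambda\big((x_1+\dots+x_n)-x_1,\ \dots,\ (x_1+\dots+x_n)-x_n\big).$$ Let $G((k),\mu,n)$ be the set of pairs $(S,T)\in \mathrm{SSYT}((k),n)\times \mathrm{SYT}(\mu)$ such that whenever $i$ appears in row $r$ of $T$, the $i$-th smallest label of $S$ (counted with multiplicity) is greater than $r$. Then $\overline{s}_{(k)}(x_1,\dots,x_n)$ has a unique expansion as an integral linear combination of the Schur polynomials $s_\nu(x_1,\dots,x_n)$ over partitions $\nu$ with at most $n$ parts, and the coefficient of $s_\mu$ in it (understood to be $0$ if $\mu$ has more than $n$ parts) is $$[s_\mu]\,\overline{s}_{(k)}(x_1,\dots,x_n)=|G((k),\mu,n)|.$$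 Moreover, if $\mu$ has fewer than $n$ parts, there is a bijection $\mathrm{SYT}(\mu+(1^{n-1}))\to G((k),\mu,n)$, $U\mapsto(S,T)$, described as follows. Let $a_1<\dots<a_{n-1}$ be the labels in the first column of $U$ and let $a_n=n+k$. Then $(S,T)$ is the unique pair in $\mathrm{SSYT}((k),n)\times\mathrm{SYT}(\mu)$ such that for each $2\le i\le n$ the label $i$ occurs exactly $a_i-a_{i-1}-1$ times in $S$, and the labels of $T$ are in the same relative order as those of $U$ with its first column deleted. -/

import Mathlib

/-!
Conventions. Partitions are Young diagrams in Mathlib's sense: the cells are pairs `(r, c)` with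
`r` and `c` counted from `0`, so `r` stands for the `(r + 1)`-st row. Tableau labels are counted
from `1`, as usual. The size of `μ` is `μ.card`, and its number of parts (rows) is `μ.colLen 0`.
-/

namespace Plethysm

open MvPolynomial

/-- `SSYT(μ, n)`: the semistandard Young tableaux of shape `μ` with labels in `{1, …, n}`. -/
def SSYT (μ : YoungDiagram) (n : ℕ) : Set (SemistandardYoungTableau μ) :=
  {T | ∀ p ∈ μ.cells, 1 ≤ T p.1 p.2 ∧ T p.1 p.2 ≤ n}

/-- `SYT(μ) = SYT(μ, |μ|)`: the tableaux of shape `μ` with labels in `{1, …, |μ|}` that use each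
label at most once and are strictly increasing along rows (and along columns). -/
def SYT (μ : YoungDiagram) : Set (SemistandardYoungTableau μ) :=
  {T | T ∈ SSYT μ μ.card ∧
    (∀ p ∈ μ.cells, ∀ q ∈ μ.cells, T p.1 p.2 = T q.1 q.2 → p = q) ∧
    (∀ r c₁ c₂ : ℕ, c₁ < c₂ → (r, c₂) ∈ μ → T r c₁ < T r c₂)}

theorem SSYT_finite (μ : YoungDiagram) (n : ℕ) : (SSYT μ n).Finite := by
  classical
  let F : SemistandardYoungTableau μ → (μ.cells → ℕ) := fun T p => T p.1.1 p.1.2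
  have hF : Function.Injective F := by
    intro T T' h
    ext i j
    by_cases hij : (i, j) ∈ μ
    · exact congrFun h ⟨(i, j), hij⟩
    · rw [T.zeros hij, T'.zeros hij]
  refine Set.Finite.of_finite_image (f := F) ?_ hF.injOn
  refine (Set.Finite.pi' (fun _ : μ.cells => Set.finite_Icc 1 n)).subset ?_
  rintro _ ⟨T, hT, rfl⟩ p
  exact hT p.1 p.2

/-- `wt_i(T)`: the number of times the label `i` occurs in `T`. -/
def wt {μ : YoungDiagram} (T : SemistandardYoungTableau μ) (i : ℕ) : ℕ :=
  (μ.cells.filter fun p => T p.1 p.2 = i).card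

/-- The Schur polynomial `s_μ(x₁, …, xₙ) = ∑_{T ∈ SSYT(μ, n)} x^{wt(T)}`.
The variable `x_{i+1}` is `X i` with `i : Fin n`. -/
noncomputable def schur (n : ℕ) (μ : YoungDiagram) : MvPolynomial (Fin n) ℤ :=
  ∑ T ∈ (SSYT_finite μ n).toFinset, ∏ i : Fin n, X i ^ wt T (i.val + 1)

/-- `s̄_μ(x₁, …, xₙ) = s_μ((x₁ + ⋯ + xₙ) - x₁, …, (x₁ + ⋯ + xₙ) - xₙ)`. -/
noncomputable def schurBar (n : ℕ) (μ : YoungDiagram) : MvPolynomial (Fin n) ℤ :=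
  aeval (fun i : Fin n => (∑ j : Fin n, X j) - X i : Fin n → MvPolynomial (Fin n) ℤ) (schur n μ)

/-- `c` is the family of coefficients of a Schur expansion of `f`: it is finitely supported on
the partitions with at most `n` parts (those with `s_μ(x₁, …, xₙ) ≠ 0`) and
`f = ∑_μ c_μ s_μ(x₁, …, xₙ)`. -/
def IsSchurExpansion (n : ℕ) (f : MvPolynomial (Fin n) ℤ) (c : YoungDiagram →₀ ℤ) : Prop :=
  (∀ μ ∈ c.support, μ.colLen 0 ≤ n) ∧ f = ∑ μ ∈ c.support, c μ • schur n μ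

/-- The one-row partition `(k)`. -/
def row (k : ℕ) : YoungDiagram where
  cells := {0} ×ˢ Finset.range k
  isLowerSet := by
    rintro ⟨a, b⟩ ⟨c, d⟩ h hab
    simp only [Prod.mk_le_mk] at h
    simp only [Finset.coe_product, Finset.coe_singleton, Finset.coe_range, Set.mem_prod,
      Set.mem_singleton_iff, Set.mem_Iio] at hab ⊢
    omega

/-- The one-column partition `(1^m)`. -/
def col (m : ℕ) : YoungDiagram := (row m).transpose

/-- The componentwise sum `μ + ν` of two partitions: its row lengths are `μ_r + ν_r`. -/
def addRows (μ ν : YoungDiagram) : YoungDiagram where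
  cells := ((Finset.range (μ.colLen 0 + ν.colLen 0)) ×ˢ
    (Finset.range (μ.rowLen 0 + ν.rowLen 0))).filter fun p => p.2 < μ.rowLen p.1 + ν.rowLen p.1
  isLowerSet := by
    rintro ⟨a, b⟩ ⟨c, d⟩ h hab
    simp only [Prod.mk_le_mk] at h
    simp only [Finset.coe_filter, Finset.mem_product, Finset.mem_range, Set.mem_ofPred_eq] at hab ⊢
    have h1 := μ.rowLen_anti c a h.1
    have h2 := ν.rowLen_anti c a h.1
    omega

theorem mem_row {k r c : ℕ} : (r, c) ∈ row k ↔ r = 0 ∧ c < k := by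
  rw [← YoungDiagram.mem_cells]
  simp [row, and_comm, eq_comm]

theorem mem_addRows {μ ν : YoungDiagram} {r c : ℕ} :
    (r, c) ∈ addRows μ ν ↔ c < μ.rowLen r + ν.rowLen r := by
  rw [← YoungDiagram.mem_cells]
  simp only [addRows, Finset.mem_filter, Finset.mem_product, Finset.mem_range,
    and_iff_right_iff_imp]
  intro h
  have h1 := μ.rowLen_anti 0 r (Nat.zero_le r)
  have h2 := ν.rowLen_anti 0 r (Nat.zero_le r)
  refine ⟨?_, by omega⟩
  rcases Nat.eq_zero_or_pos (μ.rowLen r) with h0 | h0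
  · have : r < ν.colLen 0 := by
      rw [← YoungDiagram.mem_iff_lt_colLen, YoungDiagram.mem_iff_lt_rowLen]; omega
    omega
  · have : r < μ.colLen 0 := by
      rw [← YoungDiagram.mem_iff_lt_colLen, YoungDiagram.mem_iff_lt_rowLen]; omega
    omega

/-- The `i`-th smallest value (`i ≥ 1`) among the labels of `S`, counted with multiplicity: the
`i`-th term of the weakly increasing list of all labels. How ties between equal labels are broken
affects only which cell comes `i`-th, not its value. (The value is `0` if `i` exceeds the number of
cells.) -/
def ithSmallest {lam : YoungDiagram} (S : SemistandardYoungTableau lam) (i : ℕ) : ℕ :=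
  ((lam.cells.val.map fun p => S p.1 p.2).sort (· ≤ ·)).getD (i - 1) 0

/-- `G(λ, μ, n)`, for `|λ| = |μ|`: the pairs `(S, T) ∈ SSYT(λ, n) × SYT(μ)` such that if `i` appears
in row `r` of `T`, then the `i`-th smallest value in `S` is greater than `r`. The cell `(r, c)` lies
in the row with number `r + 1`. -/
def G (lam μ : YoungDiagram) (n : ℕ) :
    Set (SemistandardYoungTableau lam × SemistandardYoungTableau μ) :=
  {P | P.1 ∈ SSYT lam n ∧ P.2 ∈ SYT μ ∧
    ∀ r c : ℕ, (r, c) ∈ μ → r + 1 < ithSmallest P.1 (P.2 r c)}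

theorem G_finite (lam μ : YoungDiagram) (n : ℕ) : (G lam μ n).Finite :=
  ((SSYT_finite lam n).prod (SSYT_finite μ μ.card)).subset fun _ h => ⟨h.1, h.2.1.1⟩

/-- For a tableau `S` of shape `μ + (1^{n-1})`, where `|μ| = k`: the numbers `a_1, …, a_n`, where
`a_1, …, a_{n-1}` are the labels in the first column of `S` from top to bottom and `a_n = n + k`. -/
def colLabel {μ : YoungDiagram} (n k : ℕ)
    (S : SemistandardYoungTableau (addRows μ (col (n - 1)))) (i : ℕ) : ℕ :=
  if i < n then S (i - 1) 0 else n + k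

/-- The relation between a tableau `U` of shape `μ + (1^{n-1})` and a pair `(S, T)` of tableaux of
shapes `(k)` and `μ`: with `a_1, …, a_n` as in `colLabel`, the label `i` occurs in `S` exactly
`a_i - a_{i-1} - 1` times for `2 ≤ i ≤ n`, and the labels of `T` are in the same relative order as
those of `U` with its first column deleted. -/
def Corresponds {μ : YoungDiagram} (n k : ℕ)
    (U : SemistandardYoungTableau (addRows μ (col (n - 1))))
    (S : SemistandardYoungTableau (row k)) (T : SemistandardYoungTableau μ) : Prop :=
  (∀ i : ℕ, 2 ≤ i → i ≤ n →
    (wt S i : ℤ) = (colLabel n k U i : ℤ) - (colLabel n k U (i - 1) : ℤ) - 1) ∧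
  (∀ p ∈ μ.cells, ∀ q ∈ μ.cells,
    (T p.1 p.2 < T q.1 q.2 ↔ U p.1 (p.2 + 1) < U q.1 (q.2 + 1)))

end Plethysm

/-! Write `n = m + 1` and `p = x_1 + ⋯ + x_n`. Everything on the symmetric-function side is
multiplied by the Vandermonde determinant, which turns Schur polynomials into alternants
(`alternant_beads`). That bialternant formula is an induction on the number of variables: removing
the largest label from a tableau (`schurEval_succ`) obeys the same recursion as a column reduction
of the alternant (`alternant_succ`).

At the points `p - x_i` the alternant of the shape `(k)` has exponents `0, …, m - 1, k + m`. Laplace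
expansion along its last column gives terms `±(p - x_i)^(k + m)` times a Vandermonde determinant in
the other `p - x_j`, which up to sign is the one in the other `x_j`. Since `p - x_i` is the sum of
those other `m` variables, iterating the Pieri rule (`sum_pow_mul_alternant`) yields a sum of
alternants over ballot words of length `k + m` in `m` letters. Summing over `i` reassembles
determinants with an extra exponent `0`. Such a determinant vanishes unless all `m` letters occur,
and otherwise belongs to the content of the word with its first column removed. So for `μ` with
fewer than `n` parts the coefficient of `s_μ` is the number of ballot words of content `μ + (1^m)`,
that is, of standard tableaux of that shape (`ncard_SYT`). Uniqueness holds because alternants with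
different increasing exponents share no monomial.

For the bijection, telescoping the multiplicities from `a_n = n + k` gives `a_i = i + #{labels of S
at most i}` (`corresponds_iff`). A standard `U` is determined by its first column and the relative
order of the rest, and the first column being smaller than the rest of its row translates exactly
into the condition defining `G` (`firstCol_le`, `exists_corresponds_of_G`). If `μ` has at least `n`
parts, the coefficient is `0` and `G` is empty. -/

namespace Plethysm

open MvPolynomial Finset

/-! ### Alternants: Pieri rule, reduction by one variable, Laplace expansions. -/

section Alternant

variable {R : Type*} [CommRing R]

theorem prod_sub_comm {n : ℕ} (f g : Fin n → R) :
    ∏ i, (f i - g i) = (-1) ^ n * ∏ i, (g i - f i) := by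
  simpa [Finset.prod_const, neg_sub] using Finset.prod_mul_distrib (s := Finset.univ)
    (f := fun _ : Fin n => (-1 : R)) (g := fun i => g i - f i)

/-- The alternant `det (x_i ^ l_j)`. -/
def alternant {n : ℕ} (x : Fin n → R) (l : Fin n → ℕ) : R :=
  (Matrix.of fun i j => x i ^ l j).det

theorem alternant_val {n : ℕ} (x : Fin n → R) :
    alternant x (fun j => (j : ℕ)) = (Matrix.vandermonde x).det := rfl

theorem alternant_eq_zero {n : ℕ} (x : Fin n → R) (l : Fin n → ℕ) {i j : Fin n} (hij : i ≠ j)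
    (h : l i = l j) : alternant x l = 0 :=
  Matrix.det_zero_of_column_eq hij fun k => by simp [h]

/-- In the Leibniz term of `σ`, rewrite the sum as `∑ j, x (σ j)`; the factor `x (σ j)` raises the
exponent of column `j` by one. -/
theorem sum_mul_alternant {n : ℕ} (x : Fin n → R) (l : Fin n → ℕ) :
    (∑ i, x i) * alternant x l = ∑ j, alternant x (l + Pi.single j 1) := by
  simp only [alternant, Matrix.det_apply, Matrix.of_apply]
  rw [Finset.sum_comm, Finset.mul_sum]
  refine Finset.sum_congr rfl fun σ _ => ?_
  rw [← Finset.smul_sum, mul_smul_comm, ← Equiv.sum_comp σ x, Finset.sum_mul]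
  congr 1
  refine Finset.sum_congr rfl fun j _ => ?_
  simp only [Pi.add_apply, pow_add, Finset.prod_mul_distrib]
  rw [mul_comm]
  congr 1
  rw [Finset.prod_eq_single j] <;> simp +contextual

/-- Subtracting from each column a power of `y = x (Fin.last n)` times the preceding one clears the
last row except for its first entry. In the remaining minor each difference of powers is divisible
by `x i - y`, and multilinearity in the columns expands the quotients into a sum over interlacing
exponents `m`. -/
theorem alternant_succ {n : ℕ} (x : Fin (n + 1) → R) (l : Fin (n + 1) → ℕ) (hl : StrictMono l) :
    alternant x l = (∏ i : Fin n, (x (Fin.last n) - x i.castSucc)) *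
      ∑ m ∈ Fintype.piFinset (fun j : Fin n => Finset.Ico (l j.castSucc) (l j.succ)),
        x (Fin.last n) ^ (l 0 + ∑ j : Fin n, (l j.succ - 1 - m j)) *
          alternant (fun i => x i.castSucc) m := by
  set y := x (Fin.last n) with hy
  let B : Matrix (Fin (n + 1)) (Fin (n + 1)) R := Matrix.of fun i =>
    Fin.cons (x i ^ l 0) fun j : Fin n =>
      x i ^ l j.castSucc * (x i ^ (l j.succ - l j.castSucc) - y ^ (l j.succ - l j.castSucc))
  have hlt (j : Fin n) : l j.castSucc < l j.succ := hl (Fin.castSucc_lt_succ)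
  have h1 : alternant x l = B.det := by
    refine Matrix.det_eq_of_forall_col_eq_smul_add_pred
      (fun j => y ^ (l j.succ - l j.castSucc)) (fun i => by simp [B]) fun i j => ?_
    simp only [Matrix.of_apply, B, Fin.cons_succ]
    rw [mul_sub, ← pow_add, Nat.add_sub_cancel' (hlt j).le]
    ring
  have h2 : B.det = (-1) ^ n * y ^ l 0 *
      (B.submatrix Fin.castSucc Fin.succ).det := by
    rw [Matrix.det_succ_row B (Fin.last n), Finset.sum_eq_single 0]
    · simp [B, hy, Fin.succAbove_last, Fin.succAbove_zero]
    · intro b _ hb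
      obtain ⟨j, rfl⟩ := Fin.exists_succ_eq.mpr hb
      simp [B, hy]
    · simp
  have h3 : (B.submatrix Fin.castSucc Fin.succ).det = (∏ i : Fin n, (x i.castSucc - y)) *
      (Matrix.of fun i j : Fin n => ∑ m ∈ Finset.Ico (l j.castSucc) (l j.succ),
        y ^ (l j.succ - 1 - m) * x i.castSucc ^ m).det := by
    rw [← Matrix.det_mul_column]
    congr 1
    ext i j
    simp only [Matrix.submatrix_apply, B, Matrix.of_apply, Fin.cons_succ]
    rw [Finset.sum_Ico_eq_sum_range, ← (Commute.all (x i.castSucc) y).geom_sum₂_mul, mul_comm _ (x i.castSucc - y),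
      mul_left_comm, Finset.mul_sum]
    congr 1
    refine Finset.sum_congr rfl fun t _ => ?_
    rw [pow_add, show l j.succ - l j.castSucc - 1 - t = l j.succ - 1 - (l j.castSucc + t) by omega]
    ring
  have h4 : (Matrix.of fun i j : Fin n => ∑ m ∈ Finset.Ico (l j.castSucc) (l j.succ),
        y ^ (l j.succ - 1 - m) * x i.castSucc ^ m).det =
      ∑ m ∈ Fintype.piFinset (fun j : Fin n => Finset.Ico (l j.castSucc) (l j.succ)),
        y ^ (∑ j : Fin n, (l j.succ - 1 - m j)) * alternant (fun i => x i.castSucc) m := by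
    rw [← Matrix.det_transpose]
    have := (Matrix.detRowAlternating (n := Fin n) (R := R)).toMultilinearMap.map_sum_finset
      (fun (j : Fin n) (m : ℕ) => fun i : Fin n => y ^ (l j.succ - 1 - m) * x i.castSucc ^ m)
      (fun j : Fin n => Finset.Ico (l j.castSucc) (l j.succ))
    have e : (Matrix.of fun i j : Fin n => ∑ m ∈ Finset.Ico (l j.castSucc) (l j.succ),
        y ^ (l j.succ - 1 - m) * x i.castSucc ^ m).transpose = fun j : Fin n =>
        ∑ m ∈ Finset.Ico (l j.castSucc) (l j.succ),
          fun i : Fin n => y ^ (l j.succ - 1 - m) * x i.castSucc ^ m := by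
      ext j i
      simp
    rw [e]
    refine this.trans (Finset.sum_congr rfl fun m _ => ?_)
    rw [alternant, ← Matrix.det_transpose, ← Finset.prod_pow_eq_pow_sum]
    exact Matrix.det_mul_column (fun j => y ^ (l j.succ - 1 - m j))
      (Matrix.of fun i j => x i.castSucc ^ m j).transpose
  rw [h1, h2, h3, h4]
  have h5 : (∏ i : Fin n, (x i.castSucc - y)) = (-1) ^ n * ∏ i : Fin n, (y - x i.castSucc) :=
    prod_sub_comm _ _
  rw [h5]
  have h6 : ((-1 : R) ^ n) * (-1) ^ n = 1 := by rw [← mul_pow]; simp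
  simp only [pow_add, mul_assoc]
  rw [← Finset.mul_sum]
  linear_combination (y ^ l 0 * (∏ i : Fin n, (y - x i.castSucc)) *
    ∑ m ∈ Fintype.piFinset (fun j : Fin n => Finset.Ico (l j.castSucc) (l j.succ)),
        y ^ (∑ j : Fin n, (l j.succ - 1 - m j)) * alternant (fun i => x i.castSucc) m) * h6

theorem alternant_val_succ {n : ℕ} (x : Fin (n + 1) → R) : alternant x (fun j => (j : ℕ)) =
    (∏ i : Fin n, (x (Fin.last n) - x i.castSucc)) *
      alternant (fun i => x i.castSucc) (fun j => (j : ℕ)) := by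
  rw [alternant_succ x _ (fun a b h => h), Finset.sum_eq_single (fun j : Fin n => (j : ℕ))]
  · simp
  · intro m hm hne
    refine absurd (_root_.funext fun j => ?_) hne
    have := Fintype.mem_piFinset.mp hm j
    simp at this
    omega
  · intro h
    simp at h

theorem alternant_last {m : ℕ} (x : Fin (m + 1) → R) (l : Fin m → ℕ) (N : ℕ) :
    alternant x (Fin.snoc l N : Fin (m + 1) → ℕ) =
      ∑ i : Fin (m + 1), (-1) ^ (i + m : ℕ) * x i ^ N * alternant (fun j => x (i.succAbove j)) l := by
  rw [alternant, Matrix.det_succ_column _ (Fin.last m)]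
  refine Finset.sum_congr rfl fun i _ => ?_
  simp only [Matrix.of_apply, Fin.snoc_last, Fin.val_last, Fin.succAbove_last, alternant]
  congr 2
  ext a b
  simp

/-- Read from right to left, this reassembles a signed sum over omitted variables into a single
alternant. -/
theorem alternant_zero_cons {m : ℕ} (x : Fin (m + 1) → R) (l : Fin m → ℕ) :
    alternant x (Fin.cons 0 l : Fin (m + 1) → ℕ) =
      ∑ i : Fin (m + 1), (-1) ^ (i : ℕ) * alternant (fun j => x (i.succAbove j)) l := by
  rw [alternant, Matrix.det_succ_column_zero]
  refine Finset.sum_congr rfl fun i _ => ?_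
  simp only [Matrix.of_apply, Fin.cons_zero, pow_zero, mul_one, alternant]
  congr 2

/-- Each of the `n.choose 2` differences in the Vandermonde product changes sign. -/
theorem vandermonde_const_sub {n : ℕ} (p : R) (x : Fin n → R) :
    alternant (fun i => p - x i) (fun j => (j : ℕ)) =
      (-1) ^ (n.choose 2) * alternant x (fun j => (j : ℕ)) := by
  induction n with
  | zero => simp [alternant]
  | succ n ih =>
    rw [alternant_val_succ, alternant_val_succ x, ih, Nat.choose_succ_succ' n 1, Nat.choose_one_right, pow_add]
    have : (∏ i : Fin n, (p - x (Fin.last n) - (p - x i.castSucc))) =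
        (-1) ^ n * ∏ i : Fin n, (x (Fin.last n) - x i.castSucc) := by
      rw [← prod_sub_comm]
      exact Finset.prod_congr rfl fun i _ => by ring
    rw [this]
    ring

end Alternant

end Plethysm

namespace Plethysm

open MvPolynomial Finset

/-! ### Diagrams with at most `n` rows as strictly increasing exponent sequences. -/

section Diagrams

/-- The diagram with row lengths `f 0, …, f (n - 1)`, if these are weakly decreasing. -/
def ofRows (n : ℕ) (f : ℕ → ℕ) : YoungDiagram where
  -- Testing all rows up to `p.1` makes this a lower set even when `f` is not decreasing.
  cells := (Finset.range n ×ˢ Finset.range (f 0)).filter fun p => ∀ r ≤ p.1, p.2 < f r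
  isLowerSet := by
    rintro ⟨a, b⟩ ⟨c, d⟩ h hab
    simp only [Prod.mk_le_mk] at h
    simp only [Finset.coe_filter, Finset.mem_product, Finset.mem_range, Set.mem_ofPred_eq] at hab ⊢
    refine ⟨by omega, fun r hr => ?_⟩
    have := hab.2 r (by omega)
    omega

theorem mem_ofRows {n : ℕ} {f : ℕ → ℕ} {r c : ℕ} :
    (r, c) ∈ ofRows n f ↔ r < n ∧ ∀ r' ≤ r, c < f r' := by
  rw [← YoungDiagram.mem_cells]
  simp only [ofRows, Finset.mem_filter, Finset.mem_product, Finset.mem_range]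
  refine ⟨fun h => ⟨h.1.1, h.2⟩, fun h => ⟨⟨h.1, h.2 0 (Nat.zero_le _)⟩, h.2⟩⟩

theorem rowLen_ext {μ ν : YoungDiagram} (h : ∀ r, μ.rowLen r = ν.rowLen r) : μ = ν := by
  ext ⟨r, c⟩
  rw [YoungDiagram.mem_cells, YoungDiagram.mem_cells, YoungDiagram.mem_iff_lt_rowLen,
    YoungDiagram.mem_iff_lt_rowLen, h]

theorem rowLen_eq_of_mem_iff {μ : YoungDiagram} {r a : ℕ} (h : ∀ c, (r, c) ∈ μ ↔ c < a) :
    μ.rowLen r = a := by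
  have h1 := h (μ.rowLen r)
  have h2 := h a
  rw [YoungDiagram.mem_iff_lt_rowLen] at h1 h2
  omega

theorem rowLen_ofRows {n : ℕ} {f : ℕ → ℕ} (hf : Antitone f) {r : ℕ} (hr : r < n) :
    (ofRows n f).rowLen r = f r :=
  rowLen_eq_of_mem_iff fun c => by
    rw [mem_ofRows]
    exact ⟨fun h => h.2 r le_rfl, fun h => ⟨hr, fun r' hr' => h.trans_le (hf hr')⟩⟩

theorem colLen_le_iff {μ : YoungDiagram} {n : ℕ} : μ.colLen 0 ≤ n ↔ ∀ r, n ≤ r → μ.rowLen r = 0 := by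
  constructor
  · intro h r hr
    by_contra h0
    have : (r, 0) ∈ μ := YoungDiagram.mem_iff_lt_rowLen.mpr (Nat.pos_of_ne_zero h0)
    have := YoungDiagram.mem_iff_lt_colLen.mp this
    omega
  · intro h
    by_contra h0
    have : (n, 0) ∈ μ := YoungDiagram.mem_iff_lt_colLen.mpr (by omega)
    have := YoungDiagram.mem_iff_lt_rowLen.mp this
    rw [h n le_rfl] at this
    omega

theorem colLen_ofRows {n : ℕ} {f : ℕ → ℕ} : (ofRows n f).colLen 0 ≤ n :=
  colLen_le_iff.mpr fun r hr => rowLen_eq_of_mem_iff fun c => by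
    rw [mem_ofRows]
    omega

theorem card_eq_sum_rowLen {μ : YoungDiagram} {n : ℕ} (h : μ.colLen 0 ≤ n) :
    μ.card = ∑ r ∈ Finset.range n, μ.rowLen r := by
  rw [YoungDiagram.card, Finset.card_eq_sum_card_fiberwise (f := Prod.fst) (t := Finset.range n)]
  · exact Finset.sum_congr rfl fun r _ => μ.rowLen_eq_card.symm
  · rintro ⟨r, c⟩ hp
    have h1 := YoungDiagram.mem_iff_lt_rowLen.mp ((YoungDiagram.mem_cells _).mp hp)
    by_contra h2
    rw [colLen_le_iff.mp h r (by simpa using h2)] at h1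
    omega

/-- The strictly increasing exponents `μ_{n-j} + j`, for `j = 0, …, n - 1`. -/
def beads (n : ℕ) (μ : YoungDiagram) (j : Fin n) : ℕ :=
  μ.rowLen (n - 1 - j) + j

theorem beads_strictMono (n : ℕ) (μ : YoungDiagram) : StrictMono (beads n μ) := by
  intro i j h
  have h1 := μ.rowLen_anti (n - 1 - j) (n - 1 - i) (by have : (i : ℕ) < j := h; omega)
  have : (i : ℕ) < j := h
  simp only [beads]
  omega

theorem beads_injOn {n : ℕ} {μ ν : YoungDiagram} (hμ : μ.colLen 0 ≤ n) (hν : ν.colLen 0 ≤ n)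
    (h : beads n μ = beads n ν) : μ = ν := by
  refine rowLen_ext fun r => ?_
  by_cases hr : r < n
  · have := congrFun h ⟨n - 1 - r, by omega⟩
    simp only [beads] at this
    rw [show n - 1 - (n - 1 - r) = r by omega] at this
    omega
  · rw [colLen_le_iff.mp hμ r (by omega), colLen_le_iff.mp hν r (by omega)]

/-- The half-open intervals between consecutive beads are disjoint and ordered, so one choice from
each is increasing and encodes a diagram. -/
theorem strictMono_of_interlacing {n : ℕ} {μ : YoungDiagram} {m : Fin n → ℕ}
    (hm : ∀ j, beads (n + 1) μ j.castSucc ≤ m j ∧ m j < beads (n + 1) μ j.succ) :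
    StrictMono m := by
  intro i j hij
  have h1 : beads (n + 1) μ i.succ ≤ beads (n + 1) μ j.castSucc :=
    (beads_strictMono _ _).monotone (by
      have : (i : ℕ) < j := hij
      rw [Fin.le_def]; simp; omega)
  exact (hm i).2.trans_le (h1.trans (hm j).1)

/-- The diagram with a given strictly increasing sequence of exponents `beads`. -/
def ofBeads {n : ℕ} (m : Fin n → ℕ) : YoungDiagram :=
  ofRows n fun r => if h : r < n then m ⟨n - 1 - r, by omega⟩ - (n - 1 - r) else 0

theorem add_le_of_strictMono {n : ℕ} {m : Fin n → ℕ} (hm : StrictMono m) (d : ℕ) (i j : Fin n)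
    (h : (j : ℕ) = i + d) : m i + d ≤ m j := by
  induction d generalizing j with
  | zero => rw [show j = i from Fin.ext h]; rfl
  | succ d ih =>
    have hlt : (i : ℕ) + d < n := by have := j.isLt; omega
    have h1 := ih ⟨i + d, hlt⟩ rfl
    have h2 : m ⟨i + d, hlt⟩ < m j := hm (by rw [Fin.lt_def]; simp; omega)
    omega

theorem val_le_of_strictMono {n : ℕ} {m : Fin n → ℕ} (hm : StrictMono m) (j : Fin n) :
    (j : ℕ) ≤ m j := by
  have := add_le_of_strictMono hm j ⟨0, j.pos⟩ j (by simp)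
  omega

theorem sub_le_sub_of_strictMono {n : ℕ} {m : Fin n → ℕ} (hm : StrictMono m) {i j : Fin n}
    (h : i ≤ j) : m i - i ≤ m j - j := by
  have h' : (i : ℕ) ≤ j := h
  have := add_le_of_strictMono hm (j - i) i j (by omega)
  omega

theorem rowLen_ofBeads {n : ℕ} {m : Fin n → ℕ} (hm : StrictMono m) {r : ℕ} (hr : r < n) :
    (ofBeads m).rowLen r = m ⟨n - 1 - r, by omega⟩ - (n - 1 - r) := by
  rw [ofBeads, rowLen_ofRows _ hr, dif_pos hr]
  intro a b hab
  by_cases hb : b < n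
  · simp only [dif_pos hb, dif_pos (hab.trans_lt hb)]
    exact sub_le_sub_of_strictMono hm (i := ⟨n - 1 - b, by omega⟩) (j := ⟨n - 1 - a, by omega⟩)
      (by rw [Fin.le_def]; simp; omega)
  · simp [hb]

theorem colLen_ofBeads {n : ℕ} {m : Fin n → ℕ} : (ofBeads m).colLen 0 ≤ n := colLen_ofRows

theorem beads_ofBeads {n : ℕ} {m : Fin n → ℕ} (hm : StrictMono m) : beads n (ofBeads m) = m := by
  funext j
  have h1 : (⟨n - 1 - (n - 1 - j), by omega⟩ : Fin n) = j := Fin.ext (by simp; omega)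
  have h2 : (j : ℕ) ≤ m j := val_le_of_strictMono hm j
  rw [beads, rowLen_ofBeads hm (by omega), h1]
  omega

theorem ofBeads_beads {n : ℕ} {μ : YoungDiagram} (hμ : μ.colLen 0 ≤ n) :
    ofBeads (beads n μ) = μ :=
  beads_injOn colLen_ofBeads hμ (beads_ofBeads (beads_strictMono n μ))

end Diagrams

/-! ### Branching rule for Schur polynomials and the bialternant formula. -/

section Branching

variable {μ ν : YoungDiagram}

theorem SSYT_mono (T : SemistandardYoungTableau μ) {a b c d : ℕ} (hac : a ≤ c) (hbd : b ≤ d)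
    (h : (c, d) ∈ μ) : T a b ≤ T c d :=
  (T.row_weak_of_le hbd (μ.up_left_mem hac le_rfl h)).trans (T.col_weak hac h)

theorem row_lt_of_mem_SSYT {n : ℕ} {T : SemistandardYoungTableau μ} (hT : T ∈ SSYT μ n) {r c : ℕ}
    (h : (r, c) ∈ μ) : r < T r c := by
  induction r with
  | zero => exact (hT _ ((YoungDiagram.mem_cells _).mpr h)).1
  | succ r ih =>
    have h1 := ih (μ.up_left_mem (Nat.le_succ r) le_rfl h)
    have h2 := T.col_strict (Nat.lt_add_one r) h
    omega

/-- The shape formed by the cells with labels at most `n`. -/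
def shapeBelow (T : SemistandardYoungTableau μ) (n : ℕ) : YoungDiagram where
  cells := μ.cells.filter fun p => T p.1 p.2 ≤ n
  isLowerSet := by
    rintro ⟨a, b⟩ ⟨c, d⟩ h hab
    simp only [Prod.mk_le_mk] at h
    simp only [Finset.coe_filter, YoungDiagram.mem_cells, Set.mem_ofPred_eq] at hab ⊢
    exact ⟨μ.up_left_mem h.1 h.2 hab.1, (SSYT_mono T h.1 h.2 hab.1).trans hab.2⟩

theorem mem_shapeBelow {T : SemistandardYoungTableau μ} {n r c : ℕ} :
    (r, c) ∈ shapeBelow T n ↔ (r, c) ∈ μ ∧ T r c ≤ n := by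
  rw [← YoungDiagram.mem_cells]
  simp [shapeBelow]

/-- The restriction of a tableau to a smaller shape. -/
def restrictShape (T : SemistandardYoungTableau μ) (h : ν ≤ μ) : SemistandardYoungTableau ν where
  entry i j := if (i, j) ∈ ν then T i j else 0
  row_weak' := by
    intro i j1 j2 hj hm
    rw [if_pos hm, if_pos (ν.up_left_mem le_rfl hj.le hm)]
    exact T.row_weak hj (h hm)
  col_strict' := by
    intro i1 i2 j hi hm
    rw [if_pos hm, if_pos (ν.up_left_mem hi.le le_rfl hm)]
    exact T.col_strict hi (h hm)
  zeros' := fun hm => if_neg hm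

theorem restrictShape_apply (T : SemistandardYoungTableau μ) (h : ν ≤ μ) {i j : ℕ}
    (hm : (i, j) ∈ ν) : restrictShape T h i j = T i j := if_pos hm

/-- The extension of a tableau to a larger shape by the label `n + 1`. -/
def extendShape (n : ℕ) (T : SemistandardYoungTableau ν) (hT : T ∈ SSYT ν n)
    (hs : ∀ r c, (r + 1, c) ∈ μ → (r, c) ∈ ν) : SemistandardYoungTableau μ where
  entry i j := if (i, j) ∈ μ then if (i, j) ∈ ν then T i j else n + 1 else 0
  row_weak' := by
    intro i j1 j2 hj hm
    rw [if_pos hm, if_pos (μ.up_left_mem le_rfl hj.le hm)]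
    by_cases h2 : (i, j2) ∈ ν
    · rw [if_pos h2, if_pos (ν.up_left_mem le_rfl hj.le h2)]
      exact T.row_weak hj h2
    · rw [if_neg h2]
      split_ifs with h1
      · exact (hT _ ((YoungDiagram.mem_cells _).mpr h1)).2.trans (Nat.le_succ n)
      · exact le_rfl
  col_strict' := by
    intro i1 i2 j hi hm
    have h1 : (i1, j) ∈ ν := hs i1 j (μ.up_left_mem hi le_rfl hm)
    rw [if_pos hm, if_pos (μ.up_left_mem hi.le le_rfl hm), if_pos h1]
    split_ifs with h2
    · exact T.col_strict hi h2
    · exact Nat.lt_succ_of_le (hT _ ((YoungDiagram.mem_cells _).mpr h1)).2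
  zeros' := fun hm => if_neg hm

theorem extendShape_apply (n : ℕ) (T : SemistandardYoungTableau ν) (hT : T ∈ SSYT ν n)
    (hs : ∀ r c, (r + 1, c) ∈ μ → (r, c) ∈ ν) (i j : ℕ) :
    extendShape n T hT hs i j = if (i, j) ∈ μ then if (i, j) ∈ ν then T i j else n + 1 else 0 := rfl

variable {R : Type*} [CommRing R]

/-- The value of a Schur polynomial at `x`. -/
noncomputable def schurEval {n : ℕ} (x : Fin n → R) (μ : YoungDiagram) : R :=
  ∑ T ∈ (SSYT_finite μ n).toFinset, ∏ i : Fin n, x i ^ wt T (i.val + 1)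

theorem aeval_schur [Algebra ℤ R] {n : ℕ} (x : Fin n → R) (μ : YoungDiagram) :
    aeval x (schur n μ) = schurEval x μ := by
  simp [schur, schurEval, map_sum, map_prod]

theorem schurEval_X (n : ℕ) (μ : YoungDiagram) :
    schurEval (fun i : Fin n => (X i : MvPolynomial (Fin n) ℤ)) μ = schur n μ := rfl

theorem prod_wt_of_shapeBelow {n : ℕ} (x : Fin (n + 1) → R) (h : ν ≤ μ)
    {T : SemistandardYoungTableau μ} (hT : T ∈ SSYT μ (n + 1)) (hν : shapeBelow T n = ν) :
    ∏ i : Fin (n + 1), x i ^ wt T (i.val + 1) = x (Fin.last n) ^ (μ.card - ν.card) *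
      ∏ i : Fin n, x i.castSucc ^ wt (restrictShape T h) (i.val + 1) := by
  rw [Fin.prod_univ_castSucc, mul_comm]
  congr 2
  · rw [YoungDiagram.card, YoungDiagram.card, ← Finset.card_sdiff_of_subset h, wt]
    congr 1
    ext ⟨r, c⟩
    simp only [Finset.mem_filter, Finset.mem_sdiff, YoungDiagram.mem_cells, ← hν, mem_shapeBelow,
      Fin.val_last]
    constructor
    · rintro ⟨h1, h2⟩
      exact ⟨h1, fun h3 => by omega⟩
    · rintro ⟨h1, h2⟩
      have := (hT _ ((YoungDiagram.mem_cells _).mpr h1)).2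
      refine ⟨h1, ?_⟩
      by_contra h3
      exact h2 ⟨h1, by simp at this; omega⟩
  · funext i
    congr 1
    rw [wt, wt]
    congr 1
    ext ⟨r, c⟩
    simp only [Finset.mem_filter, YoungDiagram.mem_cells, Fin.val_castSucc]
    constructor
    · rintro ⟨h1, h2⟩
      have h3 : (r, c) ∈ ν := by
        rw [← hν, mem_shapeBelow]
        exact ⟨h1, by omega⟩
      exact ⟨h3, by rw [restrictShape_apply _ _ h3, h2]⟩
    · rintro ⟨h1, h2⟩
      rw [restrictShape_apply _ _ h1] at h2
      exact ⟨h h1, h2⟩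

-- The label `n + 1` fills exactly the cells outside `ν`, so restriction to `ν` loses nothing and
-- `extendShape` inverts it. The hypothesis `hs` says that `μ / ν` is a horizontal strip.
open Classical in
theorem sum_shapeBelow_eq {n : ℕ} (x : Fin (n + 1) → R) (h : ν ≤ μ)
    (hs : ∀ r c, (r + 1, c) ∈ μ → (r, c) ∈ ν) :
    ∑ T ∈ (SSYT_finite μ (n + 1)).toFinset with shapeBelow T n = ν,
      ∏ i : Fin (n + 1), x i ^ wt T (i.val + 1) =
    x (Fin.last n) ^ (μ.card - ν.card) * schurEval (fun i => x i.castSucc) ν := by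
  rw [schurEval, Finset.mul_sum]
  refine Finset.sum_bij (fun T _ => restrictShape T h) ?_ ?_ ?_ ?_
  · intro T hT
    simp only [Finset.mem_filter, Set.Finite.mem_toFinset] at hT ⊢
    rintro ⟨r, c⟩ hp
    rw [YoungDiagram.mem_cells] at hp
    dsimp only
    rw [restrictShape_apply _ _ hp]
    refine ⟨(hT.1 _ ((YoungDiagram.mem_cells _).mpr (h hp))).1, ?_⟩
    rw [← hT.2, mem_shapeBelow] at hp
    exact hp.2
  · intro T hT T' hT' heq
    simp only [Finset.mem_filter, Set.Finite.mem_toFinset] at hT hT'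
    ext i j
    by_cases hm : (i, j) ∈ μ
    · by_cases hn : (i, j) ∈ ν
      · rw [← restrictShape_apply T h hn, ← restrictShape_apply T' h hn, heq]
      · have h1 : ¬ T i j ≤ n := fun h0 => hn (by rw [← hT.2, mem_shapeBelow]; exact ⟨hm, h0⟩)
        have h2 : ¬ T' i j ≤ n := fun h0 => hn (by rw [← hT'.2, mem_shapeBelow]; exact ⟨hm, h0⟩)
        have h3 := (hT.1 _ ((YoungDiagram.mem_cells _).mpr hm)).2
        have h4 := (hT'.1 _ ((YoungDiagram.mem_cells _).mpr hm)).2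
        dsimp only at h3 h4
        omega
    · rw [T.zeros hm, T'.zeros hm]
  · intro T hT
    rw [Set.Finite.mem_toFinset] at hT
    refine ⟨extendShape n T hT hs, ?_, ?_⟩
    · simp only [Finset.mem_filter, Set.Finite.mem_toFinset]
      constructor
      · rintro ⟨r, c⟩ hp
        rw [YoungDiagram.mem_cells] at hp
        dsimp only
        rw [extendShape_apply, if_pos hp]
        split_ifs with h1
        · have := hT _ ((YoungDiagram.mem_cells _).mpr h1)
          dsimp only at this
          omega
        · omega
      · ext ⟨r, c⟩
        rw [YoungDiagram.mem_cells, YoungDiagram.mem_cells, mem_shapeBelow, extendShape_apply]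
        constructor
        · rintro ⟨h1, h2⟩
          by_contra h3
          rw [if_pos h1, if_neg h3] at h2
          omega
        · intro h1
          rw [if_pos (h h1), if_pos h1]
          exact ⟨h h1, (hT _ ((YoungDiagram.mem_cells _).mpr h1)).2⟩
    · ext i j
      by_cases hm : (i, j) ∈ ν
      · rw [restrictShape_apply _ _ hm, extendShape_apply, if_pos (h hm), if_pos hm]
      · rw [SemistandardYoungTableau.zeros _ hm, SemistandardYoungTableau.zeros _ hm]
  · intro T hT
    simp only [Finset.mem_filter, Set.Finite.mem_toFinset] at hT
    exact prod_wt_of_shapeBelow x h hT.1 hT.2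

-- Group tableaux by the shape of their labels at most `n`. Column strictness makes this shape
-- interlace with `μ`, which in terms of beads is membership in the product of intervals.
open Classical in
theorem schurEval_succ {n : ℕ} (x : Fin (n + 1) → R) (hμ : μ.colLen 0 ≤ n + 1) :
    schurEval x μ = ∑ m ∈ Fintype.piFinset (fun j : Fin n =>
        Finset.Ico (beads (n + 1) μ j.castSucc) (beads (n + 1) μ j.succ)),
      x (Fin.last n) ^ (beads (n + 1) μ 0 + ∑ j : Fin n, (beads (n + 1) μ j.succ - 1 - m j)) *
        schurEval (fun i => x i.castSucc) (ofBeads m) := by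
  have interl {T : SemistandardYoungTableau μ} (hT : T ∈ SSYT μ (n + 1)) (r : ℕ) :
      μ.rowLen (r + 1) ≤ (shapeBelow T n).rowLen r ∧ (shapeBelow T n).rowLen r ≤ μ.rowLen r := by
    constructor
    · by_contra! h0
      have h1 := YoungDiagram.mem_iff_lt_rowLen.mpr h0
      have h2 := T.col_strict (Nat.lt_add_one r) h1
      have h3 := (hT _ ((YoungDiagram.mem_cells _).mpr h1)).2
      have h4 : (r, (shapeBelow T n).rowLen r) ∈ shapeBelow T n :=
        mem_shapeBelow.mpr ⟨μ.up_left_mem (Nat.le_succ r) le_rfl h1, by dsimp only at h3; omega⟩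
      exact (YoungDiagram.mem_iff_lt_rowLen.mp h4).false
    · by_contra! h0
      have h1 := YoungDiagram.mem_iff_lt_rowLen.mpr h0
      exact (YoungDiagram.mem_iff_lt_rowLen.mp (mem_shapeBelow.mp h1).1).false
  have hcol {T : SemistandardYoungTableau μ} (hT : T ∈ SSYT μ (n + 1)) :
      (shapeBelow T n).colLen 0 ≤ n := by
    by_contra! h0
    have h1 := mem_shapeBelow.mp (YoungDiagram.mem_iff_lt_colLen.mpr h0)
    have := row_lt_of_mem_SSYT hT h1.1
    omega
  rw [schurEval, ← Finset.sum_fiberwise_of_maps_to (g := fun T => beads n (shapeBelow T n))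
    (t := Fintype.piFinset (fun j : Fin n =>
        Finset.Ico (beads (n + 1) μ j.castSucc) (beads (n + 1) μ j.succ)))]
  · refine Finset.sum_congr rfl fun m hm => ?_
    have hm' (j : Fin n) := Finset.mem_Ico.mp (Fintype.mem_piFinset.mp hm j)
    have hmono := strictMono_of_interlacing hm'
    have hrow (r : ℕ) (hr : r < n) : μ.rowLen (r + 1) ≤ (ofBeads m).rowLen r ∧
        (ofBeads m).rowLen r ≤ μ.rowLen r := by
      have := hm' ⟨n - 1 - r, by omega⟩
      rw [rowLen_ofBeads hmono hr]
      simp only [beads, Fin.val_castSucc, Fin.val_succ] at this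
      rw [show n + 1 - 1 - (n - 1 - r) = r + 1 by omega,
        show n + 1 - 1 - (n - 1 - r + 1) = r by omega] at this
      omega
    have hle : ofBeads m ≤ μ := by
      rintro ⟨r, c⟩ hp
      have hp' := YoungDiagram.mem_iff_lt_rowLen.mp ((YoungDiagram.mem_cells _).mp hp)
      have hr : r < n := by
        by_contra h0
        rw [colLen_le_iff.mp colLen_ofBeads r (by omega)] at hp'
        omega
      exact (YoungDiagram.mem_cells _).mpr
        (YoungDiagram.mem_iff_lt_rowLen.mpr (hp'.trans_le (hrow r hr).2))
    have hs : ∀ r c, (r + 1, c) ∈ μ → (r, c) ∈ ofBeads m := by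
      intro r c hp
      have hp' := YoungDiagram.mem_iff_lt_rowLen.mp hp
      have hr : r < n := by
        by_contra h0
        rw [colLen_le_iff.mp hμ (r + 1) (by omega)] at hp'
        omega
      exact YoungDiagram.mem_iff_lt_rowLen.mpr (hp'.trans_le (hrow r hr).1)
    -- Bead `j` of the inner shape is its row `n - 1 - j`, so the summands count the removed cells
    -- row by row; `beads (n + 1) μ 0` is the bottom row of `μ`, which is removed entirely.
    have hexp : beads (n + 1) μ 0 + ∑ j : Fin n, (beads (n + 1) μ j.succ - 1 - m j) =
        μ.card - (ofBeads m).card := by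
      have h1 : ∀ j : Fin n, beads (n + 1) μ j.succ - 1 - m j =
          μ.rowLen (Fin.rev j) - (ofBeads m).rowLen (Fin.rev j) := by
        intro j
        rw [rowLen_ofBeads hmono (Fin.rev j).isLt]
        have e : (⟨n - 1 - (Fin.rev j : ℕ), by omega⟩ : Fin n) = j :=
          Fin.ext (by simp [Fin.val_rev]; omega)
        rw [e]
        have := val_le_of_strictMono hmono j
        simp only [beads, Fin.val_succ, Fin.val_rev]
        rw [show n + 1 - 1 - (j + 1) = n - (j + 1) by omega]
        omega
      rw [Finset.sum_congr rfl fun j _ => h1 j]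
      simp only [← Fin.revPerm_apply]
      rw [
        Equiv.sum_comp (Fin.revPerm (n := n)) (fun j : Fin n => μ.rowLen j - (ofBeads m).rowLen j),
        Fin.sum_univ_eq_sum_range (fun r => μ.rowLen r - (ofBeads m).rowLen r),
        card_eq_sum_rowLen hμ, card_eq_sum_rowLen (n := n) (μ := ofBeads m) colLen_ofBeads,
        Finset.sum_range_succ,
        Finset.sum_tsub_distrib _ fun r hr => (hrow r (Finset.mem_range.mp hr)).2]
      have := Finset.sum_le_sum fun r hr => (hrow r (Finset.mem_range.mp hr)).2
      simp only [beads, Fin.val_zero, Nat.add_sub_cancel, Nat.sub_zero, Nat.add_zero]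
      omega
    rw [hexp, ← sum_shapeBelow_eq x hle hs]
    refine Finset.sum_congr (Finset.filter_congr fun T hT => ?_) fun _ _ => rfl
    rw [Set.Finite.mem_toFinset] at hT
    constructor
    · rintro rfl
      exact (ofBeads_beads (hcol hT)).symm
    · rintro h
      rw [h, beads_ofBeads hmono]
  · intro T hT
    rw [Set.Finite.mem_toFinset] at hT
    refine Fintype.mem_piFinset.mpr fun j => Finset.mem_Ico.mpr ?_
    have := interl hT (n - 1 - j)
    simp only [beads, Fin.val_castSucc, Fin.val_succ]
    rw [show n - 1 - j + 1 = n + 1 - 1 - j by omega] at this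
    rw [show n + 1 - 1 - (j + 1) = n - 1 - j by omega]
    omega

/-- The bialternant formula. -/
theorem alternant_beads {n : ℕ} (x : Fin n → R) (hμ : μ.colLen 0 ≤ n) :
    alternant x (beads n μ) = alternant x (fun j => (j : ℕ)) * schurEval x μ := by
  induction n generalizing μ with
  | zero =>
    have hcells : μ.cells = ∅ := by
      rw [← Finset.card_eq_zero]
      exact card_eq_sum_rowLen hμ
    have : (SSYT_finite μ 0).toFinset = {default} := by
      ext T
      simp only [Set.Finite.mem_toFinset, Finset.mem_singleton]
      constructor
      · intro _
        ext i j
        have : (i, j) ∉ μ := by rw [← YoungDiagram.mem_cells, hcells]; simp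
        rw [SemistandardYoungTableau.zeros _ this, SemistandardYoungTableau.zeros _ this]
      · rintro - p hp
        rw [hcells] at hp
        simp at hp
    simp [schurEval, this, alternant]
  | succ n ih =>
    -- Both sides now run over the same interlacing `m` with the same power of the last variable.
    rw [schurEval_succ x hμ, alternant_succ x _ (beads_strictMono _ _), alternant_val_succ, mul_assoc]
    congr 1
    rw [Finset.mul_sum]
    refine Finset.sum_congr rfl fun m hm => ?_
    have hm' (j : Fin n) := Finset.mem_Ico.mp (Fintype.mem_piFinset.mp hm j)
    have hmono := strictMono_of_interlacing hm'
    have := ih (fun i => x i.castSucc) (μ := ofBeads m) colLen_ofBeads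
    rw [beads_ofBeads hmono] at this
    rw [this]
    ring

end Branching

end Plethysm

namespace Plethysm

open MvPolynomial Finset

/-! ### Ballot words and powers of the sum of the variables. -/

section Words

/-- For a weakly increasing `f` on `{0, …, L - 1}`, the values at most `a` occupy an initial
segment. -/
theorem lt_card_filter_le_iff {L : ℕ} {f : ℕ → ℕ} (hf : ∀ i j, i ≤ j → j < L → f i ≤ f j) {c : ℕ}
    (hc : c < L) (a : ℕ) : c < #{i ∈ Finset.range L | f i ≤ a} ↔ f c ≤ a := by
  constructor
  · intro h
    by_contra! h0
    have : {i ∈ Finset.range L | f i ≤ a} ⊆ Finset.range c := by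
      intro i hi
      simp only [Finset.mem_filter, Finset.mem_range] at hi ⊢
      by_contra! h1
      have := hf c i h1 hi.1
      omega
    have := Finset.card_le_card this
    rw [Finset.card_range] at this
    omega
  · intro h
    have : Finset.range (c + 1) ⊆ {i ∈ Finset.range L | f i ≤ a} := by
      intro i hi
      simp only [Finset.mem_filter, Finset.mem_range] at hi ⊢
      exact ⟨by omega, (hf i c (by omega) hc).trans h⟩
    have := Finset.card_le_card this
    rw [Finset.card_range] at this
    omega

/-- The number of occurrences of the letter `r` among the first `a` letters of `w`. -/
def letterCount {N m : ℕ} (w : Fin N → Fin m) (a r : ℕ) : ℕ :=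
  #{i : Fin N | i.val < a ∧ (w i).val = r}

/-- The ballot words. -/
def IsBallot {N m : ℕ} (w : Fin N → Fin m) : Prop :=
  ∀ a ≤ N, Antitone (letterCount w a)

variable {N m : ℕ}

theorem letterCount_zero (w : Fin N → Fin m) (r : ℕ) : letterCount w 0 r = 0 := by
  simp [letterCount]

theorem letterCount_eq_zero (w : Fin N → Fin m) (a : ℕ) {r : ℕ} (hr : m ≤ r) :
    letterCount w a r = 0 := by
  simp only [letterCount, Finset.card_eq_zero, Finset.filter_eq_empty_iff]
  rintro i - ⟨-, h⟩
  omega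

theorem letterCount_mono (w : Fin N → Fin m) (r : ℕ) {a b : ℕ} (h : a ≤ b) :
    letterCount w a r ≤ letterCount w b r := by
  refine Finset.card_le_card fun i hi => ?_
  simp only [Finset.mem_filter, Finset.mem_univ, true_and] at hi ⊢
  exact ⟨hi.1.trans_le h, hi.2⟩

theorem letterCount_succ (w : Fin N → Fin m) (r : ℕ) (a : Fin N) :
    letterCount w (a + 1) r = letterCount w a r + if (w a).val = r then 1 else 0 := by
  have : Finset.univ.filter (fun i : Fin N => i.val < a.val + 1 ∧ (w i).val = r) =
      Finset.univ.filter (fun i : Fin N => i.val < a.val ∧ (w i).val = r) ∪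
        (if (w a).val = r then {a} else ∅) := by
    ext i
    simp only [Finset.mem_union, Finset.mem_filter, Finset.mem_univ, true_and]
    constructor
    · rintro ⟨h1, h2⟩
      rcases Nat.lt_succ_iff_lt_or_eq.mp h1 with h | h
      · exact Or.inl ⟨h, h2⟩
      · obtain rfl := Fin.ext h
        right
        rw [if_pos h2]
        simp
    · rintro (⟨h1, h2⟩ | h)
      · exact ⟨by omega, h2⟩
      · split_ifs at h with h3
        · obtain rfl := Finset.mem_singleton.mp h
          exact ⟨by omega, h3⟩
        · simp at h
  rw [letterCount, letterCount, this, Finset.card_union_of_disjoint]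
  · split_ifs <;> simp
  · split_ifs <;> simp

theorem letterCount_snoc (w : Fin N → Fin m) (s : Fin m) {a : ℕ} (ha : a ≤ N) (r : ℕ) :
    letterCount (Fin.snoc w s : Fin (N + 1) → Fin m) a r = letterCount w a r := by
  simp only [letterCount, Fin.univ_castSuccEmb, Finset.filter_cons, Fin.val_last]
  rw [if_neg (by omega), Finset.filter_map, Finset.card_map]
  congr 1
  refine Finset.filter_congr fun i _ => ?_
  simp

theorem letterCount_snoc_last (w : Fin N → Fin m) (s : Fin m) (r : ℕ) :
    letterCount (Fin.snoc w s : Fin (N + 1) → Fin m) (N + 1) r =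
      letterCount w N r + if s.val = r then 1 else 0 := by
  have := letterCount_succ (Fin.snoc w s : Fin (N + 1) → Fin m) r (Fin.last N)
  rw [Fin.snoc_last, Fin.val_last, letterCount_snoc w s le_rfl] at this
  exact this

theorem isBallot_snoc (w : Fin N → Fin m) (s : Fin m) :
    IsBallot (Fin.snoc w s : Fin (N + 1) → Fin m) ↔
      IsBallot w ∧ Antitone fun r => letterCount w N r + if s.val = r then 1 else 0 := by
  constructor
  · intro h
    refine ⟨fun a ha r r' hr => ?_, fun r r' hr => ?_⟩
    · have := h a (by omega) hr
      rwa [letterCount_snoc w s ha, letterCount_snoc w s ha] at this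
    · have := h (N + 1) le_rfl hr
      rwa [letterCount_snoc_last, letterCount_snoc_last] at this
  · rintro ⟨h1, h2⟩ a ha r r' hr
    rcases Nat.le_succ_iff.mp ha with h | rfl
    · rw [letterCount_snoc w s h, letterCount_snoc w s h]
      exact h1 a h hr
    · rw [letterCount_snoc_last, letterCount_snoc_last]
      exact h2 hr

/-- The exponents attached to the content of a word. -/
def wordBeads (w : Fin N → Fin m) (j : Fin m) : ℕ := j + letterCount w N (m - 1 - j)

variable {R : Type*} [CommRing R]

-- Iterated Pieri rule: a word records which exponent is raised at each step. Leaving the ballot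
-- words makes two exponents equal, so those terms vanish.
open Classical in
theorem sum_pow_mul_alternant (x : Fin m → R) (N : ℕ) :
    (∑ i, x i) ^ N * alternant x (fun j => (j : ℕ)) =
      ∑ w : Fin N → Fin m with IsBallot w, alternant x (wordBeads w) := by
  induction N with
  | zero =>
    have h1 (w : Fin 0 → Fin m) : IsBallot w := fun a ha r r' hr => by simp [letterCount]
    have h2 (w : Fin 0 → Fin m) : wordBeads w = fun j : Fin m => (j : ℕ) := by
      funext j; simp [wordBeads, letterCount]
    simp [h1, h2]
  | succ N ih =>
    rw [pow_succ', mul_assoc, ih, Finset.mul_sum, Finset.sum_filter, Finset.sum_filter,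
      ← (Fin.snocEquiv fun _ : Fin (N + 1) => Fin m).sum_comp, Fintype.sum_prod_type_right]
    refine Finset.sum_congr rfl fun w _ => ?_
    have hsnoc (s : Fin m) : (Fin.snocEquiv fun _ : Fin (N + 1) => Fin m) (s, w) =
      (Fin.snoc w s : Fin (N + 1) → Fin m) := rfl
    simp only [hsnoc, isBallot_snoc]
    by_cases hw : IsBallot w
    -- The letter `s` stands for row `s`, whose exponent sits in column `Fin.rev s`; hence the
    -- reindexing.
    · rw [if_pos hw, sum_mul_alternant, ← Equiv.sum_comp Fin.revPerm]
      refine Finset.sum_congr rfl fun s _ => ?_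
      have hb : wordBeads (Fin.snoc w s : Fin (N + 1) → Fin m) =
          wordBeads w + Pi.single (Fin.revPerm s) 1 := by
        funext j
        simp only [wordBeads, letterCount_snoc_last, Pi.add_apply, Pi.single_apply,
          Fin.revPerm_apply, Fin.ext_iff, Fin.val_rev, add_assoc]
        congr 3
        rw [eq_iff_iff]
        omega
      rw [hb]
      split_ifs with h
      · rfl
      · have h' : ¬ Antitone fun r => letterCount w N r + if s.val = r then 1 else 0 :=
          fun h0 => h ⟨hw, h0⟩
        -- Appending `s` breaks the ballot condition only if `s - 1` and `s` occurred equally often.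
        -- Raising the exponent of `s` then makes it equal to that of `s - 1`.
        have hs : 0 < s.val ∧ letterCount w N (s.val - 1) = letterCount w N s.val := by
          by_contra! h0
          refine h' (antitone_nat_of_succ_le fun r => ?_)
          have h1 := hw N le_rfl (Nat.le_succ r)
          rw [Nat.succ_eq_add_one] at h1
          by_cases hr : s.val = r + 1
          · have h2 := h0 (by omega)
            rw [hr, Nat.add_sub_cancel] at h2
            rw [if_pos hr, if_neg (by omega)]
            omega
          · rw [if_neg hr]
            omega
        refine alternant_eq_zero x _ (i := Fin.rev s) (j := Fin.rev ⟨s.val - 1, by omega⟩)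
          (fun he => ?_) ?_
        · have := congrArg Fin.val (Fin.rev_injective he)
          simp only at this
          omega
        · have h3 : m - 1 - (m - (s.val + 1)) = s.val := by omega
          have h4 : m - 1 - (m - (s.val - 1 + 1)) = s.val - 1 := by omega
          have h5 : ¬ m - (s.val - 1 + 1) = m - (s.val + 1) := by omega
          simp only [wordBeads, Pi.add_apply, Fin.revPerm_apply, Pi.single_apply, Fin.ext_iff,
            Fin.val_rev, h3, h4, h5, hs.2, if_true, if_false]
          omega
    · simp [hw]

end Words

/-! ### Standard tableaux correspond to ballot words. -/

section StandardTableaux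

variable {μ : YoungDiagram}

theorem SYT_label_le {T : SemistandardYoungTableau μ} (hT : T ∈ SYT μ) {r c : ℕ}
    (h : (r, c) ∈ μ) : 1 ≤ T r c ∧ T r c ≤ μ.card :=
  hT.1 _ ((YoungDiagram.mem_cells _).mpr h)

theorem SYT_inj {T : SemistandardYoungTableau μ} (hT : T ∈ SYT μ) {r c r' c' : ℕ}
    (h : (r, c) ∈ μ) (h' : (r', c') ∈ μ) (he : T r c = T r' c') : r = r' ∧ c = c' :=
  Prod.mk_inj.mp (hT.2.1 _ ((YoungDiagram.mem_cells _).mpr h) _ ((YoungDiagram.mem_cells _).mpr h') he)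

theorem SYT_image {T : SemistandardYoungTableau μ} (hT : T ∈ SYT μ) :
    μ.cells.image (fun p => T p.1 p.2) = Finset.Icc 1 μ.card := by
  refine Finset.eq_of_subset_of_card_le ?_ ?_
  · intro a ha
    obtain ⟨p, hp, rfl⟩ := Finset.mem_image.mp ha
    exact Finset.mem_Icc.mpr (hT.1 p hp)
  · rw [Finset.card_image_of_injOn fun p hp q hq h => hT.2.1 p hp q hq h]
    simp [YoungDiagram.card]

theorem SYT_surj {T : SemistandardYoungTableau μ} (hT : T ∈ SYT μ) {a : ℕ} (h1 : 1 ≤ a)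
    (h2 : a ≤ μ.card) : ∃ r c, (r, c) ∈ μ ∧ T r c = a := by
  have : a ∈ μ.cells.image (fun p => T p.1 p.2) := by
    rw [SYT_image hT]
    exact Finset.mem_Icc.mpr ⟨h1, h2⟩
  obtain ⟨⟨r, c⟩, hp, he⟩ := Finset.mem_image.mp this
  exact ⟨r, c, (YoungDiagram.mem_cells _).mp hp, he⟩

variable {N m : ℕ}

/-- The letters of `w` are the rows of the successive labels of `T`. -/
def ReadsRows (T : SemistandardYoungTableau μ) (w : Fin N → Fin m) : Prop :=
  ∀ r c, (r, c) ∈ μ → ∃ i : Fin N, T r c = i + 1 ∧ (w i).val = r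

theorem exists_readsRows (hμ : μ.colLen 0 ≤ m) (hN : μ.card = N) {T : SemistandardYoungTableau μ}
    (hT : T ∈ SYT μ) : ∃ w : Fin N → Fin m, ReadsRows T w := by
  have h (i : Fin N) : ∃ s : Fin m, ∃ c, (s.val, c) ∈ μ ∧ T s c = i + 1 := by
    obtain ⟨r, c, hm, he⟩ := SYT_surj hT (a := i + 1) (by omega) (by omega)
    have h1 := YoungDiagram.mem_iff_lt_colLen.mp (μ.up_left_mem le_rfl (Nat.zero_le c) hm)
    exact ⟨⟨r, by omega⟩, c, hm, he⟩
  choose w d hw using h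
  refine ⟨w, fun r c hm => ?_⟩
  have hl := SYT_label_le hT hm
  refine ⟨⟨T r c - 1, by omega⟩, by simp; omega, ?_⟩
  have h1 := hw ⟨T r c - 1, by omega⟩
  exact (SYT_inj hT h1.1 hm (by rw [h1.2]; simp; omega)).1

theorem readsRows_surj (hN : μ.card = N) {T : SemistandardYoungTableau μ} (hT : T ∈ SYT μ)
    {w : Fin N → Fin m} (hw : ReadsRows T w) (i : Fin N) :
    ∃ c, ((w i).val, c) ∈ μ ∧ T (w i) c = i + 1 := by
  obtain ⟨r, c, hm, he⟩ := SYT_surj hT (a := i + 1) (by omega) (by omega)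
  obtain ⟨i', h1, h2⟩ := hw r c hm
  obtain rfl : i' = i := Fin.ext (by omega)
  exact ⟨c, by rwa [h2], by rwa [h2]⟩

theorem readsRows_unique (hN : μ.card = N) {T : SemistandardYoungTableau μ} (hT : T ∈ SYT μ)
    {w w' : Fin N → Fin m} (hw : ReadsRows T w) (hw' : ReadsRows T w') : w = w' := by
  refine _root_.funext fun i => ?_
  obtain ⟨c, h1, h2⟩ := readsRows_surj hN hT hw i
  obtain ⟨i', h3, h4⟩ := hw' _ _ h1
  obtain rfl : i' = i := Fin.ext (by omega)
  exact (Fin.ext h4).symm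

/-- This translates between tableau and word: columns of `T` give the ballot condition, and the
counts at `a = N` give the shape. -/
theorem letterCount_of_readsRows (hN : μ.card = N) {T : SemistandardYoungTableau μ}
    (hT : T ∈ SYT μ) {w : Fin N → Fin m} (hw : ReadsRows T w) (a r : ℕ) :
    letterCount w a r = #{c ∈ Finset.range (μ.rowLen r) | T r c ≤ a} := by
  symm
  have hlab {c : ℕ} (hc : c ∈ ({c ∈ Finset.range (μ.rowLen r) | T r c ≤ a} : Finset ℕ)) :
      (r, c) ∈ μ ∧ T r c ≤ a ∧ 1 ≤ T r c ∧ T r c ≤ N := by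
    rw [Finset.mem_filter, Finset.mem_range, ← YoungDiagram.mem_iff_lt_rowLen] at hc
    exact ⟨hc.1, hc.2, hN ▸ SYT_label_le hT hc.1⟩
  refine Finset.card_bij (fun c hc => ⟨T r c - 1, by have := hlab hc; omega⟩) ?_ ?_ ?_
  · intro c hc
    obtain ⟨h1, h2, h3, h4⟩ := hlab hc
    obtain ⟨i, h5, h6⟩ := hw r c h1
    have : (⟨T r c - 1, by omega⟩ : Fin N) = i := Fin.ext (by simp; omega)
    simp only [Finset.mem_filter, Finset.mem_univ, true_and, this, h6, and_true]
    omega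
  · intro c hc c' hc' h
    have h1 := hlab hc
    have h2 := hlab hc'
    simp only [Fin.mk.injEq] at h
    exact (SYT_inj hT h1.1 h2.1 (by omega)).2
  · intro i hi
    simp only [Finset.mem_filter, Finset.mem_univ, true_and] at hi
    obtain ⟨c, h1, h2⟩ := readsRows_surj hN hT hw i
    rw [hi.2] at h1 h2
    refine ⟨c, ?_, Fin.ext (by simp; omega)⟩
    rw [Finset.mem_filter, Finset.mem_range, ← YoungDiagram.mem_iff_lt_rowLen]
    exact ⟨h1, by omega⟩

theorem isBallot_of_readsRows (hN : μ.card = N) {T : SemistandardYoungTableau μ}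
    (hT : T ∈ SYT μ) {w : Fin N → Fin m} (hw : ReadsRows T w) : IsBallot w := by
  intro a _ r r' hr
  rw [letterCount_of_readsRows hN hT hw, letterCount_of_readsRows hN hT hw]
  refine Finset.card_le_card fun c hc => ?_
  rw [Finset.mem_filter, Finset.mem_range, ← YoungDiagram.mem_iff_lt_rowLen] at hc ⊢
  exact ⟨μ.up_left_mem hr le_rfl hc.1, (T.col_weak hr hc.1).trans hc.2⟩

theorem letterCount_eq_rowLen (hN : μ.card = N) {T : SemistandardYoungTableau μ}
    (hT : T ∈ SYT μ) {w : Fin N → Fin m} (hw : ReadsRows T w) (r : ℕ) :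
    letterCount w N r = μ.rowLen r := by
  rw [letterCount_of_readsRows hN hT hw, Finset.filter_true_of_mem, Finset.card_range]
  intro c hc
  rw [Finset.mem_range, ← YoungDiagram.mem_iff_lt_rowLen] at hc
  exact hN ▸ (SYT_label_le hT hc).2

/-- An increasing row is determined by how many of its labels are at most `a`, for every `a`, and
the word records these numbers. -/
theorem readsRows_injective (hN : μ.card = N) {T T' : SemistandardYoungTableau μ}
    (hT : T ∈ SYT μ) (hT' : T' ∈ SYT μ) {w : Fin N → Fin m} (hw : ReadsRows T w)
    (hw' : ReadsRows T' w) : T = T' := by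
  ext r c
  by_cases hm : (r, c) ∈ μ
  · have hc := YoungDiagram.mem_iff_lt_rowLen.mp hm
    have key (a : ℕ) : T r c ≤ a ↔ T' r c ≤ a := by
      rw [← lt_card_filter_le_iff (f := T r) (fun i j hij hj =>
          T.row_weak_of_le hij (YoungDiagram.mem_iff_lt_rowLen.mpr hj)) hc,
        ← lt_card_filter_le_iff (f := T' r) (fun i j hij hj =>
          T'.row_weak_of_le hij (YoungDiagram.mem_iff_lt_rowLen.mpr hj)) hc,
        ← letterCount_of_readsRows hN hT hw, ← letterCount_of_readsRows hN hT' hw']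
    exact le_antisymm ((key _).mpr le_rfl) ((key _).mp le_rfl)
  · rw [T.zeros hm, T'.zeros hm]

theorem exists_SYT_readsRows (hN : μ.card = N) {w : Fin N → Fin m} (hw : IsBallot w)
    (hc : ∀ r, letterCount w N r = μ.rowLen r) : ∃ T ∈ SYT μ, ReadsRows T w := by
  -- Counting the prefix lengths, from `0` on, that contain at most `c` letters `r` gives the
  -- position, counted from `1`, of the `(c + 1)`-st letter `r`.
  let f (r c : ℕ) : ℕ := #{a ∈ Finset.range (N + 1) | letterCount w a r ≤ c}
  have hf (r c a : ℕ) (ha : a ≤ N) : f r c ≤ a ↔ c < letterCount w a r := by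
    have h1 := lt_card_filter_le_iff (L := N + 1) (f := fun a => letterCount w a r)
      (fun i j hij _ => letterCount_mono w r hij) (Nat.lt_succ_of_le ha) c
    rw [← not_lt, h1, not_le]
  have hpred (r c : ℕ) (hm : (r, c) ∈ μ) : ∃ i : Fin N, f r c = i + 1 ∧ (w i).val = r ∧
      letterCount w i r = c := by
    have h1 := YoungDiagram.mem_iff_lt_rowLen.mp hm
    rw [← hc, ← hf r c N le_rfl] at h1
    have h2 := hf r c 0 (Nat.zero_le _)
    rw [letterCount_zero] at h2
    have h3 : f r c - 1 < N := by omega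
    have h4 := (hf r c (f r c) h1).mp le_rfl
    have h5 := hf r c (f r c - 1) (by omega)
    have h6 := letterCount_succ w r ⟨f r c - 1, h3⟩
    simp only [show f r c - 1 + 1 = f r c by omega] at h6
    refine ⟨⟨f r c - 1, h3⟩, by simp; omega, ?_⟩
    simp only
    split_ifs at h6 with h7
    · exact ⟨h7, by omega⟩
    · omega
  let T : SemistandardYoungTableau μ :=
    { entry := fun r c => if (r, c) ∈ μ then f r c else 0
      row_weak' := by
        intro r c c' hcc hm
        rw [if_pos hm, if_pos (μ.up_left_mem le_rfl hcc.le hm)]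
        obtain ⟨i, h1, h2, h3⟩ := hpred r c' hm
        rw [hf r c _ (by omega), h1, letterCount_succ]
        omega
      col_strict' := by
        intro r r' c hr hm
        rw [if_pos hm, if_pos (μ.up_left_mem hr.le le_rfl hm)]
        obtain ⟨i, h1, h2, h3⟩ := hpred r' c hm
        rw [h1, Nat.lt_succ_iff, hf r c _ (by omega)]
        have h4 := hw (i + 1) (by omega) hr.le
        rw [letterCount_succ, letterCount_succ, if_pos h2, if_neg (by omega)] at h4
        omega
      zeros' := fun hm => if_neg hm }
  have hTf {r c : ℕ} (hm : (r, c) ∈ μ) : T r c = f r c := if_pos hm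
  have hreads : ReadsRows T w := fun r c hm => by
    obtain ⟨i, h1, h2, h3⟩ := hpred r c hm
    exact ⟨i, by rw [hTf hm, h1], h2⟩
  refine ⟨T, ⟨?_, ?_, ?_⟩, hreads⟩
  · rintro ⟨r, c⟩ hm
    rw [YoungDiagram.mem_cells] at hm
    obtain ⟨i, h1, h2⟩ := hreads r c hm
    dsimp only
    omega
  · rintro ⟨r, c⟩ hm ⟨r', c'⟩ hm' he
    rw [YoungDiagram.mem_cells] at hm hm'
    dsimp only at he
    rw [hTf hm, hTf hm'] at he
    obtain ⟨i, h1, h2, h3⟩ := hpred r c hm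
    obtain ⟨i', h1', h2', h3'⟩ := hpred r' c' hm'
    obtain rfl : i = i' := Fin.ext (by omega)
    rw [← h3, ← h3', ← h2, ← h2']
  · intro r c c' hcc hm
    have hm1 := μ.up_left_mem le_rfl hcc.le hm
    rw [hTf hm, hTf hm1]
    obtain ⟨i, h1, h2, h3⟩ := hpred r c' hm
    rw [h1, Nat.lt_succ_iff, hf r c _ (by omega)]
    omega

open Classical in
theorem ncard_SYT (hμ : μ.colLen 0 ≤ m) (hN : μ.card = N) :
    (SYT μ).ncard =
      #{w : Fin N → Fin m | IsBallot w ∧ ∀ r, letterCount w N r = μ.rowLen r} := by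
  rw [← Set.ncard_coe_finset]
  refine Set.ncard_congr (fun T hT => (exists_readsRows hμ hN hT).choose) ?_ ?_ ?_
  · intro T hT
    have hw := (exists_readsRows hμ hN hT).choose_spec
    simp only [Finset.coe_filter, Finset.mem_univ, true_and]
    exact ⟨isBallot_of_readsRows hN hT hw, letterCount_eq_rowLen hN hT hw⟩
  · intro T T' hT hT' h
    have hw := (exists_readsRows hμ hN hT).choose_spec
    have hw' := (exists_readsRows hμ hN hT').choose_spec
    rw [← h] at hw'
    exact readsRows_injective hN hT hT' hw hw'
  · intro w hw
    simp only [Finset.coe_filter, Finset.mem_univ, true_and] at hw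
    obtain ⟨T, hT, hTw⟩ := exists_SYT_readsRows hN hw.1 hw.2
    exact ⟨T, hT, readsRows_unique hN hT (exists_readsRows hμ hN hT).choose_spec hTw⟩

end StandardTableaux

end Plethysm

namespace Plethysm

open MvPolynomial Finset

/-! ### Schur expansion of `s̄_(k)` and its uniqueness. -/

section SchurBar

variable {R : Type*} [CommRing R]

theorem rowLen_row (k r : ℕ) : (row k).rowLen r = if r = 0 then k else 0 :=
  rowLen_eq_of_mem_iff fun c => by
    rw [mem_row]
    split_ifs with h <;> simp [h]

theorem rowLen_col (m r : ℕ) : (col m).rowLen r = if r < m then 1 else 0 :=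
  rowLen_eq_of_mem_iff fun c => by
    rw [col, YoungDiagram.mem_transpose, Prod.swap_prod_mk, mem_row]
    split_ifs with h <;> simp [h]

theorem rowLen_addRows (μ ν : YoungDiagram) (r : ℕ) :
    (addRows μ ν).rowLen r = μ.rowLen r + ν.rowLen r :=
  rowLen_eq_of_mem_iff fun _ => mem_addRows

theorem beads_row (m k : ℕ) :
    beads (m + 1) (row k) = (Fin.snoc (fun j : Fin m => (j : ℕ)) (k + m) : Fin (m + 1) → ℕ) := by
  funext j
  refine Fin.lastCases ?_ (fun j => ?_) j
  · simp [beads, rowLen_row]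
  · simp only [beads, rowLen_row, Fin.val_castSucc, Fin.snoc_castSucc]
    rw [if_neg (by omega), Nat.zero_add]

open Classical in
theorem alternant_mul_schurEval_row (m k : ℕ) (x : Fin (m + 1) → R) :
    alternant x (fun j => (j : ℕ)) * schurEval (fun i => ∑ j, x j - x i) (row k) =
      ∑ w : Fin (k + m) → Fin m with IsBallot w,
        alternant x (Fin.cons 0 (wordBeads w) : Fin (m + 1) → ℕ) := by
  have hcol : (row k).colLen 0 ≤ m + 1 :=
    colLen_le_iff.mpr fun r hr => by rw [rowLen_row, if_neg (by omega)]
  have h1 := alternant_beads (fun i => ∑ j, x j - x i) hcol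
  have hsum (i : Fin (m + 1)) : ∑ j, x j - x i = ∑ j : Fin m, x (i.succAbove j) := by
    rw [Fin.sum_univ_succAbove x i, add_sub_cancel_left]
  rw [vandermonde_const_sub, beads_row, alternant_last] at h1
  -- The sign `(-1)^m` from the Laplace expansion and the sign of the smaller Vandermonde
  -- determinant combine through `m + m.choose 2 = (m + 1).choose 2`, so the sign cancels against
  -- the left side of `h1`.
  have h2 (i : Fin (m + 1)) : (-1) ^ (i + m : ℕ) * (∑ j, x j - x i) ^ (k + m) *
      alternant (fun j => ∑ j, x j - x (i.succAbove j)) (fun j : Fin m => (j : ℕ)) =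
      (-1) ^ ((m + 1).choose 2) * ∑ w : Fin (k + m) → Fin m with IsBallot w,
        (-1) ^ (i : ℕ) * alternant (fun j => x (i.succAbove j)) (wordBeads w) := by
    rw [vandermonde_const_sub, ← Finset.mul_sum, ← sum_pow_mul_alternant, hsum,
      Nat.choose_succ_succ' m 1, Nat.choose_one_right, pow_add, pow_add]
    ring
  rw [Finset.sum_congr rfl fun i _ => h2 i, ← Finset.mul_sum, Finset.sum_comm, mul_assoc] at h1
  simp only [← alternant_zero_cons] at h1
  have h3 : ((-1 : R) ^ ((m + 1).choose 2)) * (-1) ^ ((m + 1).choose 2) = 1 := by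
    rw [← mul_pow]; simp
  calc _ = (-1 : R) ^ ((m + 1).choose 2) * ((-1) ^ ((m + 1).choose 2) * (alternant x
        (fun j => (j : ℕ)) * schurEval (fun i => ∑ j, x j - x i) (row k))) := by
        rw [← mul_assoc, h3, one_mul]
    _ = _ := by rw [← h1, ← mul_assoc, h3, one_mul]

/-- The shape of the content of a word, with the first column removed. -/
def contentShape {N m : ℕ} (w : Fin N → Fin m) : YoungDiagram :=
  ofRows m fun r => letterCount w N r - 1

theorem colLen_contentShape {N m : ℕ} (w : Fin N → Fin m) : (contentShape w).colLen 0 ≤ m :=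
  colLen_ofRows

theorem rowLen_contentShape {N m : ℕ} {w : Fin N → Fin m} (hw : IsBallot w) (r : ℕ) :
    (contentShape w).rowLen r = letterCount w N r - 1 := by
  by_cases hr : r < m
  · exact rowLen_ofRows (fun a b h => Nat.sub_le_sub_right (hw N le_rfl h) 1) hr
  · rw [letterCount_eq_zero w N (by omega),
      colLen_le_iff.mp (colLen_contentShape w) r (by omega)]

/-- The prepended `0` shifts each index up by one, which compensates for the cell lost from each
row. -/
theorem beads_contentShape {N m : ℕ} {w : Fin N → Fin m} (hw : IsBallot w)
    (hpos : ∀ r < m, 0 < letterCount w N r) :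
    beads (m + 1) (contentShape w) = (Fin.cons 0 (wordBeads w) : Fin (m + 1) → ℕ) := by
  funext j
  refine Fin.cases ?_ (fun j => ?_) j
  · simp only [beads, rowLen_contentShape hw, Fin.val_zero, Fin.cons_zero]
    rw [letterCount_eq_zero w N (by omega)]
  · simp only [beads, rowLen_contentShape hw, Fin.val_succ, Fin.cons_succ, wordBeads]
    rw [show m + 1 - 1 - (j + 1) = m - 1 - j by omega]
    have := hpos (m - 1 - j) (by omega)
    omega

/-- By the ballot condition, if any letter is missing then so is the last one, `m - 1`; its exponent
is `0` and collides with the prepended `0`. -/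
theorem alternant_cons_eq_zero {N m : ℕ} (x : Fin (m + 1) → R) {w : Fin N → Fin m}
    (hw : IsBallot w) (hpos : ¬ ∀ r < m, 0 < letterCount w N r) :
    alternant x (Fin.cons 0 (wordBeads w) : Fin (m + 1) → ℕ) = 0 := by
  push Not at hpos
  obtain ⟨r, hr, h0⟩ := hpos
  have h1 := hw N le_rfl (show r ≤ m - 1 by omega)
  refine alternant_eq_zero x _ (i := 0) (j := Fin.succ ⟨0, by omega⟩) (Fin.succ_ne_zero _).symm ?_
  simp only [Fin.cons_zero, Fin.cons_succ, wordBeads, Nat.sub_zero]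
  omega

theorem alternant_X_ne_zero (n : ℕ) :
    alternant (fun i : Fin n => (X i : MvPolynomial (Fin n) ℤ)) (fun j => (j : ℕ)) ≠ 0 := by
  rw [alternant_val, Matrix.det_vandermonde_ne_zero_iff]
  exact X_injective

open Classical in
theorem schurBar_row (m k : ℕ) : schurBar (m + 1) (row k) =
    ∑ w : Fin (k + m) → Fin m with IsBallot w ∧ ∀ r < m, 0 < letterCount w (k + m) r,
      schur (m + 1) (contentShape w) := by
  apply mul_left_cancel₀ (alternant_X_ne_zero (m + 1))
  rw [schurBar, aeval_schur, alternant_mul_schurEval_row, ← Finset.filter_filter, Finset.mul_sum]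
  symm
  rw [Finset.sum_filter]
  refine Finset.sum_congr rfl fun w hw => ?_
  have hb : IsBallot w := (Finset.mem_filter.mp hw).2
  split_ifs with h
  · rw [← schurEval_X, ← alternant_beads _ ((colLen_contentShape w).trans (Nat.le_succ m)),
      beads_contentShape hb h]
  · exact (alternant_cons_eq_zero _ hb h).symm

theorem rowLen_addRows_col (μ : YoungDiagram) (m r : ℕ) :
    (addRows μ (col m)).rowLen r = μ.rowLen r + if r < m then 1 else 0 := by
  rw [rowLen_addRows, rowLen_col]

theorem colLen_addRows_col {μ : YoungDiagram} {m : ℕ} (hcol : μ.colLen 0 ≤ m) :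
    (addRows μ (col m)).colLen 0 ≤ m := colLen_le_iff.mpr fun r hr => by
  rw [rowLen_addRows_col, if_neg (by omega), colLen_le_iff.mp hcol r hr]

theorem card_addRows_col {μ : YoungDiagram} {m : ℕ} (hcol : μ.colLen 0 ≤ m) :
    (addRows μ (col m)).card = μ.card + m := by
  rw [card_eq_sum_rowLen (colLen_addRows_col hcol), card_eq_sum_rowLen hcol,
    Finset.sum_congr rfl fun r hr => by
      rw [rowLen_addRows_col, if_pos (Finset.mem_range.mp hr)], Finset.sum_add_distrib]
  simp

open Classical in
theorem card_words_contentShape (m k : ℕ) (μ : YoungDiagram) (hcol : μ.colLen 0 ≤ m)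
    (hμ : μ.card = k) :
    #{w : Fin (k + m) → Fin m | (IsBallot w ∧ ∀ r < m, 0 < letterCount w (k + m) r) ∧
      contentShape w = μ} = (SYT (addRows μ (col m))).ncard := by
  rw [ncard_SYT (colLen_addRows_col hcol) (card_addRows_col hcol |>.trans (by rw [hμ]))]
  congr 1
  refine Finset.filter_congr fun w _ => ?_
  rw [and_assoc]
  refine and_congr_right fun hw => ?_
  constructor
  · rintro ⟨hpos, rfl⟩ r
    rw [rowLen_addRows_col, rowLen_contentShape hw]
    by_cases hr : r < m
    · have := hpos r hr
      rw [if_pos hr]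
      omega
    · rw [letterCount_eq_zero w _ (by omega), if_neg hr]
  · intro h
    refine ⟨fun r hr => by rw [h, rowLen_addRows_col, if_pos hr]; omega, rowLen_ext fun r => ?_⟩
    rw [rowLen_contentShape hw, h, rowLen_addRows_col]
    split_ifs with hr
    · omega
    · rw [colLen_le_iff.mp hcol r (by omega)]

/-- Among the permuted exponent vectors of `l` only the identity gives an increasing one. -/
theorem coeff_alternant_X {n : ℕ} {l l' : Fin n → ℕ} (hl : StrictMono l) (hl' : StrictMono l') :
    coeff (Finsupp.equivFunOnFinite.symm l')
      (alternant (fun i : Fin n => (X i : MvPolynomial (Fin n) ℤ)) l) = if l = l' then 1 else 0 := by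
  have hmon (σ : Equiv.Perm (Fin n)) : ∏ i, (X (σ i) : MvPolynomial (Fin n) ℤ) ^ l i =
      monomial (Finsupp.equivFunOnFinite.symm (l ∘ σ.symm)) 1 := by
    rw [monomial_eq, map_one, one_mul, Finsupp.prod_fintype _ _ (by simp), ← Equiv.prod_comp σ (fun i => (X i : MvPolynomial (Fin n) ℤ) ^ _)]
    simp
  have hperm (σ : Equiv.Perm (Fin n)) (h : l ∘ σ.symm = l') : l = l' ∧ σ = 1 := by
    have h1 : l = l' := by
      refine hl.range_inj hl' |>.mp ?_
      rw [← h, EquivLike.range_comp]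
    refine ⟨h1, Equiv.ext fun i => hl.injective ?_⟩
    have := congrFun h (σ i)
    rw [← h1] at this
    simpa using this.symm
  simp only [alternant, Matrix.det_apply, Matrix.of_apply, hmon, coeff_sum]
  rw [Finset.sum_eq_single 1]
  · have h1 : l ∘ ((1 : Equiv.Perm (Fin n)).symm) = l := rfl
    simp [h1]
  · intro σ _ hσ
    rw [coeff_smul, coeff_monomial, if_neg, smul_zero]
    exact fun h => hσ (hperm σ (Finsupp.equivFunOnFinite.symm.injective h)).2
  · simp

theorem isSchurExpansion_iff {n : ℕ} {f : MvPolynomial (Fin n) ℤ} {c : YoungDiagram →₀ ℤ} :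
    IsSchurExpansion n f c ↔ (∀ μ ∈ c.support, μ.colLen 0 ≤ n) ∧
      f = Finsupp.linearCombination ℤ (schur n) c := Iff.rfl

/-- Schur polynomials of shapes with at most `n` rows are linearly independent. -/
theorem IsSchurExpansion.unique {n : ℕ} {f : MvPolynomial (Fin n) ℤ} {c c' : YoungDiagram →₀ ℤ}
    (hc : IsSchurExpansion n f c) (hc' : IsSchurExpansion n f c') : c = c' := by
  classical
  -- After multiplication by the Vandermonde determinant, the monomial with exponents `beads n ν`
  -- arises only from the summand of `ν`, so it isolates `c ν`.
  have key {c : YoungDiagram →₀ ℤ} (hc : IsSchurExpansion n f c) (ν : YoungDiagram)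
      (hν : ν.colLen 0 ≤ n) : c ν = coeff (Finsupp.equivFunOnFinite.symm (beads n ν))
        (alternant (fun i : Fin n => (X i : MvPolynomial (Fin n) ℤ)) (fun j => (j : ℕ)) * f) := by
    rw [hc.2, Finset.mul_sum, coeff_sum, Finset.sum_congr rfl (g := fun μ => if μ = ν then c μ else 0)]
    · simp +contextual [eq_comm]
    · intro μ hμ
      rw [mul_smul_comm, ← schurEval_X, ← alternant_beads _ (hc.1 μ hμ), coeff_smul,
        coeff_alternant_X (beads_strictMono _ _) (beads_strictMono _ _)]
      by_cases h : μ = ν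
      · simp [h]
      · rw [if_neg h, if_neg fun h0 => h (beads_injOn (hc.1 μ hμ) hν h0), smul_zero]
  ext ν
  by_cases hν : ν.colLen 0 ≤ n
  · rw [key hc ν hν, key hc' ν hν]
  · rw [Finsupp.notMem_support_iff.mp fun h => hν (hc.1 ν h),
      Finsupp.notMem_support_iff.mp fun h => hν (hc'.1 ν h)]

/-- The coefficients of the Schur expansion of `s̄_(k)` count standard Young tableaux. -/
theorem exists_isSchurExpansion_schurBar_row (m k : ℕ) :
    ∃ c : YoungDiagram →₀ ℤ, IsSchurExpansion (m + 1) (schurBar (m + 1) (row k)) c ∧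
      ∀ μ : YoungDiagram, μ.card = k →
        c μ = if μ.colLen 0 ≤ m then ((SYT (addRows μ (col m))).ncard : ℤ) else 0 := by
  classical
  let W : Finset (Fin (k + m) → Fin m) :=
    {w | IsBallot w ∧ ∀ r < m, 0 < letterCount w (k + m) r}
  let c : YoungDiagram →₀ ℤ := ∑ w ∈ W, Finsupp.single (contentShape w) 1
  have hc (μ : YoungDiagram) : c μ = #{w ∈ W | contentShape w = μ} := by
    simp [c, Finsupp.finsetSum_apply, Finsupp.single_apply, Finset.sum_boole]
  have hc0 (μ : YoungDiagram) (h : ¬ μ.colLen 0 ≤ m) : c μ = 0 := by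
    rw [hc, Finset.filter_false_of_mem, Finset.card_empty, Nat.cast_zero]
    rintro w - rfl
    exact h (colLen_contentShape w)
  refine ⟨c, isSchurExpansion_iff.mpr ⟨fun μ hμ => ?_, ?_⟩, fun μ hμ => ?_⟩
  · by_contra h
    exact Finsupp.mem_support_iff.mp hμ (hc0 μ (by omega))
  · rw [schurBar_row, map_sum]
    exact Finset.sum_congr rfl fun w _ => by simp
  · split_ifs with h
    · rw [hc, ← card_words_contentShape m k μ h hμ, Finset.filter_filter]
    · exact hc0 μ h

end SchurBar

end Plethysm

namespace Plethysm

open Finset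

/-! ### Fillings determined by relative order. -/

section Standardization

variable {μ : YoungDiagram}

/-- A value is determined by its rank in the common image. A smallest disagreement would give an
element with a smaller value where the two orders conflict. -/
theorem eqOn_of_image_eq {ι : Type*} [DecidableEq ι] {s : Finset ι} {f g : ι → ℕ}
    (himg : s.image f = s.image g) (h : ∀ p ∈ s, ∀ q ∈ s, (f p < f q ↔ g p < g q)) {p : ι}
    (hp : p ∈ s) : f p = g p := by
  suffices ∀ v, ∀ p ∈ s, f p = v → g p = v from (this _ p hp rfl).symm
  intro v
  induction v using Nat.strong_induction_on with
  | _ v ih =>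
    rintro p hp rfl
    rcases lt_trichotomy (g p) (f p) with hlt | heq | hgt
    · obtain ⟨q, hq, hqe⟩ := Finset.mem_image.mp (himg ▸ Finset.mem_image_of_mem g hp)
      have h1 := ih _ (hqe ▸ hlt) q hq rfl
      have h2 := (h q hq p hp).mp (by omega)
      omega
    · exact heq
    · obtain ⟨q, hq, hqe⟩ := Finset.mem_image.mp (himg ▸ Finset.mem_image_of_mem f hp)
      have h1 := (h q hq p hp).mpr (by omega)
      have h2 := ih _ h1 q hq rfl
      omega

/-- The standard tableau with the same relative order as a given injective filling. -/
def standardize (μ : YoungDiagram) (f : ℕ → ℕ → ℕ)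
    (hrow : ∀ r c c', c < c' → (r, c') ∈ μ → f r c < f r c')
    (hcol : ∀ r r' c, r < r' → (r', c) ∈ μ → f r c < f r' c) : SemistandardYoungTableau μ where
  entry r c := if (r, c) ∈ μ then #{q ∈ μ.cells | f q.1 q.2 ≤ f r c} else 0
  row_weak' := by
    intro r c c' hc hm
    rw [if_pos hm, if_pos (μ.up_left_mem le_rfl hc.le hm)]
    exact Finset.card_le_card
      (Finset.monotone_filter_right _ fun q _ hq => hq.trans (hrow r c c' hc hm).le)
  col_strict' := by
    intro r r' c hr hm
    rw [if_pos hm, if_pos (μ.up_left_mem hr.le le_rfl hm)]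
    have h := hcol r r' c hr hm
    refine Finset.card_lt_card ⟨Finset.monotone_filter_right _ fun q _ hq => hq.trans h.le,
      fun hs => ?_⟩
    have := (Finset.mem_filter.mp (hs (Finset.mem_filter.mpr
      ⟨(YoungDiagram.mem_cells (r', c)).mpr hm, le_rfl⟩))).2
    exact absurd this (not_le.mpr h)
  zeros' := fun hm => if_neg hm

variable {f : ℕ → ℕ → ℕ} (hrow : ∀ r c c', c < c' → (r, c') ∈ μ → f r c < f r c')
  (hcol : ∀ r r' c, r < r' → (r', c) ∈ μ → f r c < f r' c)

theorem standardize_apply {r c : ℕ} (hm : (r, c) ∈ μ) :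
    standardize μ f hrow hcol r c = #{q ∈ μ.cells | f q.1 q.2 ≤ f r c} := if_pos hm

theorem standardize_lt_iff {r c r' c' : ℕ} (hm : (r, c) ∈ μ) (hm' : (r', c') ∈ μ) :
    standardize μ f hrow hcol r c < standardize μ f hrow hcol r' c' ↔ f r c < f r' c' := by
  rw [standardize_apply hrow hcol hm, standardize_apply hrow hcol hm']
  constructor
  · intro h
    by_contra! h0
    exact absurd (Finset.card_le_card (Finset.monotone_filter_right μ.cells
      fun q _ (hq : f q.1 q.2 ≤ f r' c') => hq.trans h0)) (not_le.mpr h)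
  · intro h
    refine Finset.card_lt_card ⟨Finset.monotone_filter_right _ fun q _ hq => hq.trans h.le,
      fun hs => ?_⟩
    have := (Finset.mem_filter.mp (hs (Finset.mem_filter.mpr
      ⟨(YoungDiagram.mem_cells (r', c')).mpr hm', le_rfl⟩))).2
    exact absurd this (not_le.mpr h)

theorem standardize_mem_SYT
    (hinj : ∀ p ∈ μ.cells, ∀ q ∈ μ.cells, f p.1 p.2 = f q.1 q.2 → p = q) :
    standardize μ f hrow hcol ∈ SYT μ := by
  refine ⟨?_, ?_, ?_⟩
  · rintro ⟨r, c⟩ hm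
    have hm' := (YoungDiagram.mem_cells _).mp hm
    dsimp only
    rw [standardize_apply hrow hcol hm']
    exact ⟨Finset.card_pos.mpr ⟨(r, c), Finset.mem_filter.mpr ⟨hm, le_rfl⟩⟩,
      Finset.card_filter_le _ _⟩
  · rintro ⟨r, c⟩ hm ⟨r', c'⟩ hm' he
    refine hinj _ hm _ hm' ?_
    rw [YoungDiagram.mem_cells] at hm hm'
    have h1 := standardize_lt_iff hrow hcol hm hm'
    have h2 := standardize_lt_iff hrow hcol hm' hm
    dsimp only at he ⊢
    omega
  · intro r c c' hc hm
    exact (standardize_lt_iff hrow hcol (μ.up_left_mem le_rfl hc.le hm) hm).mpr (hrow r c c' hc hm)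

theorem SYT_eq_of_order {T T' : SemistandardYoungTableau μ} (hT : T ∈ SYT μ) (hT' : T' ∈ SYT μ)
    (h : ∀ p ∈ μ.cells, ∀ q ∈ μ.cells, (T p.1 p.2 < T q.1 q.2 ↔ T' p.1 p.2 < T' q.1 q.2)) :
    T = T' := by
  ext r c
  by_cases hm : (r, c) ∈ μ
  · exact eqOn_of_image_eq (f := fun p : ℕ × ℕ => T p.1 p.2) (g := fun p => T' p.1 p.2)
      ((SYT_image hT).trans (SYT_image hT').symm) h ((YoungDiagram.mem_cells (r, c)).mpr hm)
  · rw [T.zeros hm, T'.zeros hm]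

end Standardization

/-! ### One-row tableaux encoded by their cumulative label counts. -/

section OneRow

variable {k : ℕ}

/-- The number of labels of a one-row tableau that are at most `j`. -/
def labelCount (S : SemistandardYoungTableau (row k)) (j : ℕ) : ℕ :=
  #{c ∈ Finset.range k | S 0 c ≤ j}

theorem row_cells (k : ℕ) : (row k).cells = {0} ×ˢ Finset.range k := rfl

theorem row_mono (S : SemistandardYoungTableau (row k)) (i j : ℕ) (hij : i ≤ j) (hj : j < k) :
    S 0 i ≤ S 0 j :=
  S.row_weak_of_le hij (mem_row.mpr ⟨rfl, hj⟩)

theorem lt_labelCount_iff (S : SemistandardYoungTableau (row k)) {c : ℕ} (hc : c < k) (j : ℕ) :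
    c < labelCount S j ↔ S 0 c ≤ j :=
  lt_card_filter_le_iff (row_mono S) hc j

theorem labelCount_mono (S : SemistandardYoungTableau (row k)) : Monotone (labelCount S) :=
  fun _ _ h => Finset.card_le_card
    (Finset.monotone_filter_right _ fun _ _ hc => hc.trans h)

theorem labelCount_le (S : SemistandardYoungTableau (row k)) (j : ℕ) : labelCount S j ≤ k :=
  (Finset.card_filter_le _ _).trans (Finset.card_range k).le

theorem wt_row (S : SemistandardYoungTableau (row k)) (i : ℕ) :
    wt S i = #{c ∈ Finset.range k | S 0 c = i} := by
  rw [wt, row_cells, Finset.singleton_product, Finset.filter_map, Finset.card_map]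
  rfl

theorem labelCount_succ (S : SemistandardYoungTableau (row k)) (i : ℕ) :
    labelCount S (i + 1) = labelCount S i + wt S (i + 1) := by
  rw [wt_row, labelCount, labelCount, ← Finset.card_union_of_disjoint]
  · rw [← Finset.filter_or]
    congr 1
    exact Finset.filter_congr fun c _ => Nat.le_succ_iff
  · exact Finset.disjoint_filter.mpr fun c _ h => by omega

variable {n : ℕ} {S : SemistandardYoungTableau (row k)}

theorem one_le_of_mem_SSYT_row (hS : S ∈ SSYT (row k) n) {c : ℕ} (hc : c < k) :
    1 ≤ S 0 c ∧ S 0 c ≤ n :=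
  hS (0, c) ((YoungDiagram.mem_cells _).mpr (mem_row.mpr ⟨rfl, hc⟩))

theorem labelCount_zero (hS : S ∈ SSYT (row k) n) : labelCount S 0 = 0 := by
  rw [labelCount, Finset.card_eq_zero, Finset.filter_eq_empty_iff]
  intro c hc
  have := one_le_of_mem_SSYT_row hS (Finset.mem_range.mp hc)
  omega

theorem labelCount_of_le (hS : S ∈ SSYT (row k) n) {j : ℕ} (hj : n ≤ j) : labelCount S j = k := by
  rw [labelCount, Finset.filter_true_of_mem, Finset.card_range]
  intro c hc
  have := one_le_of_mem_SSYT_row hS (Finset.mem_range.mp hc)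
  omega

/-- The counts at `0` and from `m + 1` on are forced, so the `m` intermediate ones determine the
row. -/
theorem row_eq_of_labelCount {m : ℕ} {S' : SemistandardYoungTableau (row k)}
    (hS : S ∈ SSYT (row k) (m + 1)) (hS' : S' ∈ SSYT (row k) (m + 1))
    (h : ∀ r < m, labelCount S (r + 1) = labelCount S' (r + 1)) : S = S' := by
  have h' (j : ℕ) : labelCount S j = labelCount S' j := by
    rcases j with _ | r
    · rw [labelCount_zero hS, labelCount_zero hS']
    · by_cases hr : r < m
      · exact h r hr
      · rw [labelCount_of_le hS (by omega), labelCount_of_le hS' (by omega)]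
  ext r c
  by_cases hm : (r, c) ∈ row k
  · obtain ⟨rfl, hc⟩ := mem_row.mp hm
    have key (j : ℕ) : S 0 c ≤ j ↔ S' 0 c ≤ j := by
      rw [← lt_labelCount_iff S hc, ← lt_labelCount_iff S' hc, h']
    exact le_antisymm ((key _).mpr le_rfl) ((key _).mp le_rfl)
  · rw [S.zeros hm, S'.zeros hm]

theorem exists_row_labelCount {m : ℕ} {α : ℕ → ℕ} (hα : ∀ i j, i ≤ j → j < m → α i ≤ α j)
    (hk : ∀ r < m, α r ≤ k) :
    ∃ S ∈ SSYT (row k) (m + 1), ∀ r < m, labelCount S (r + 1) = α r := by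
  let S : SemistandardYoungTableau (row k) :=
    -- Cell `c` exceeds the label `s + 1` exactly when `α s ≤ c`; its label is one more than the
    -- number of such `s`.
    { entry := fun r c => if (r, c) ∈ row k then 1 + #{s ∈ Finset.range m | α s ≤ c} else 0
      row_weak' := by
        intro r c c' hc hm
        rw [if_pos hm, if_pos ((row k).up_left_mem le_rfl hc.le hm)]
        exact Nat.add_le_add_left (Finset.card_le_card
          (Finset.monotone_filter_right _ fun s _ hs => hs.trans hc.le)) 1
      col_strict' := by
        intro r r' c hr hm
        have := (mem_row.mp hm).1
        omega
      zeros' := fun hm => if_neg hm }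
  have hS {c : ℕ} (hc : c < k) : S 0 c = 1 + #{s ∈ Finset.range m | α s ≤ c} :=
    if_pos (mem_row.mpr ⟨rfl, hc⟩)
  refine ⟨S, ?_, ?_⟩
  · rintro ⟨r, c⟩ hm
    obtain ⟨rfl, hc⟩ := mem_row.mp ((YoungDiagram.mem_cells _).mp hm)
    dsimp only
    rw [hS hc]
    have := (Finset.card_filter_le (Finset.range m) fun s => α s ≤ c).trans (Finset.card_range m).le
    omega
  · intro r hr
    rw [labelCount, ← Finset.card_range (α r)]
    congr 1
    ext c
    rw [Finset.mem_filter, Finset.mem_range, Finset.mem_range]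
    have h1 := lt_card_filter_le_iff hα hr c
    have h2 := hk r hr
    constructor
    · rintro ⟨h3, h4⟩
      rw [hS h3] at h4
      omega
    · intro h3
      have h4 : c < k := by omega
      rw [hS h4]
      omega

theorem ithSmallest_row (S : SemistandardYoungTableau (row k)) {i : ℕ} (h1 : 1 ≤ i) (hi : i ≤ k) :
    ithSmallest S i = S 0 (i - 1) := by
  have h : ((row k).cells.val.map fun p => S p.1 p.2).sort (· ≤ ·) =
      (List.range k).map (S 0) := by
    have hperm : ((row k).cells.val.map fun p => S p.1 p.2) = ((List.range k).map (S 0) : Multiset ℕ) := by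
      rw [row_cells, Finset.singleton_product, Finset.map_val, Multiset.map_map]
      rfl
    rw [hperm]
    refine List.Perm.eq_of_pairwise (le := (· ≤ ·)) (fun a b _ _ => le_antisymm) (Multiset.pairwise_sort _ _) ?_ ?_
    · rw [List.pairwise_map]
      refine List.Pairwise.imp_of_mem ?_ (List.pairwise_lt_range (n := k))
      intro a b _ hb hab
      exact row_mono S a b hab.le (List.mem_range.mp hb)
    · rw [← Multiset.coe_eq_coe, Multiset.sort_eq]
  rw [ithSmallest, h, List.getD_eq_getElem _ _ (by simp; omega)]
  simp

end OneRow

end Plethysm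

namespace Plethysm

open Finset

/-! ### The bijection between `SYT (addRows μ (col m))` and `G (row k) μ (m + 1)`. -/

section Bijection

variable {μ : YoungDiagram} {m k : ℕ}

theorem mem_addRows_col_zero (hcol : μ.colLen 0 ≤ m) {r : ℕ} :
    (r, 0) ∈ addRows μ (col m) ↔ r < m := by
  rw [YoungDiagram.mem_iff_lt_rowLen, rowLen_addRows_col]
  split_ifs with h
  · simp [h]
  · simp [h, colLen_le_iff.mp hcol r (by omega)]

theorem mem_addRows_col_succ (hcol : μ.colLen 0 ≤ m) {r c : ℕ} :
    (r, c + 1) ∈ addRows μ (col m) ↔ (r, c) ∈ μ := by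
  rw [YoungDiagram.mem_iff_lt_rowLen, rowLen_addRows_col, YoungDiagram.mem_iff_lt_rowLen]
  split_ifs with h
  · omega
  · rw [colLen_le_iff.mp hcol r (by omega)]
    omega

theorem lt_of_mem (hcol : μ.colLen 0 ≤ m) {r c : ℕ} (hm : (r, c) ∈ μ) : r < m := by
  have := YoungDiagram.mem_iff_lt_colLen.mp (μ.up_left_mem le_rfl (Nat.zero_le c) hm)
  omega

/-- The `i`-th smallest label exceeds `r + 1` exactly when fewer than `i` labels are at most `r +
1`. -/
theorem mem_G_row (hμ : μ.card = k) {n : ℕ} {S : SemistandardYoungTableau (row k)}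
    {T : SemistandardYoungTableau μ} :
    (S, T) ∈ G (row k) μ n ↔ S ∈ SSYT (row k) n ∧ T ∈ SYT μ ∧
      ∀ r c, (r, c) ∈ μ → labelCount S (r + 1) < T r c := by
  refine and_congr_right fun hS => and_congr_right fun hT => forall_congr' fun r =>
    forall_congr' fun c => forall_congr' fun hm => ?_
  have h : 1 ≤ T r c ∧ T r c ≤ k := hμ ▸ SYT_label_le hT hm
  have := lt_labelCount_iff S (c := T r c - 1) (by omega) (r + 1)
  dsimp only
  rw [ithSmallest_row S h.1 h.2]
  omega

/-- A cell of `μ` in the `n`-th row would require a label of `S` greater than `n`. -/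
theorem G_eq_empty {n : ℕ} (hμ : μ.card = k) (hn : 0 < n) (h : n ≤ μ.colLen 0) :
    G (row k) μ n = ∅ := by
  rw [Set.eq_empty_iff_forall_notMem]
  rintro ⟨S, T⟩ hST
  obtain ⟨hS, hT, hG⟩ := (mem_G_row hμ).mp hST
  have hm : (n - 1, 0) ∈ μ := YoungDiagram.mem_iff_lt_colLen.mpr (by omega)
  have h1 := hG _ _ hm
  rw [labelCount_of_le hS (by omega)] at h1
  have := SYT_label_le hT hm
  omega

theorem corresponds_iff {U : SemistandardYoungTableau (addRows μ (col m))}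
    {S : SemistandardYoungTableau (row k)} (hS : S ∈ SSYT (row k) (m + 1))
    {T : SemistandardYoungTableau μ} :
    Corresponds (m + 1) k U S T ↔ (∀ r < m, U r 0 = r + 1 + labelCount S (r + 1)) ∧
      ∀ p ∈ μ.cells, ∀ q ∈ μ.cells,
        (T p.1 p.2 < T q.1 q.2 ↔ U p.1 (p.2 + 1) < U q.1 (q.2 + 1)) := by
  refine and_congr_left fun _ => ?_
  have hlast : labelCount S (m + 1) = k := labelCount_of_le hS le_rfl
  have hlt (r : ℕ) (hr : r < m) : colLabel (m + 1) k U (r + 1) = U r 0 :=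
    if_pos (by omega)
  have htop : colLabel (m + 1) k U (m + 1) = m + 1 + k := if_neg (by omega)
  constructor
  · intro h
    -- The relation prescribes only successive differences, and the known end is `a_n = n + k`, so
    -- the induction descends from there.
    have key (d : ℕ) : ∀ r, r + d = m → colLabel (m + 1) k U (r + 1) =
        r + 1 + labelCount S (r + 1) := by
      induction d with
      | zero =>
        rintro r rfl
        rw [htop, hlast]
      | succ d ih =>
        intro r hr
        have h1 := ih (r + 1) (by omega)
        have h2 := h (r + 1 + 1) (by omega) (by omega)
        have h3 := labelCount_succ S (r + 1)
        rw [Nat.add_sub_cancel] at h2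
        omega
    intro r hr
    rw [← hlt r hr]
    exact key (m - r) r (by omega)
  · intro h i h2 hi
    obtain ⟨r, rfl⟩ : ∃ r, i = r + 1 + 1 := ⟨i - 2, by omega⟩
    have h3 := labelCount_succ S (r + 1)
    have h4 := h r (by omega)
    rw [Nat.add_sub_cancel, hlt r (by omega)]
    by_cases hr : r + 1 < m
    · have h5 := h (r + 1) hr
      rw [hlt _ hr]
      omega
    · obtain rfl : m = r + 1 := by omega
      rw [htop]
      omega

variable {U U' : SemistandardYoungTableau (addRows μ (col m))}

theorem firstCol_lt (hcol : μ.colLen 0 ≤ m) {r r' : ℕ} (h : r < r') (hr' : r' < m) :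
    U r 0 < U r' 0 := U.col_strict h ((mem_addRows_col_zero hcol).mpr hr')

theorem mem_image_tail_iff (hcol : μ.colLen 0 ≤ m) (hμ : μ.card = k)
    (hU : U ∈ SYT (addRows μ (col m))) (a : ℕ) :
    a ∈ μ.cells.image (fun p => U p.1 (p.2 + 1)) ↔
      1 ≤ a ∧ a ≤ k + m ∧ ∀ r < m, U r 0 ≠ a := by
  have hcard : (addRows μ (col m)).card = k + m := by rw [card_addRows_col hcol, hμ]
  rw [Finset.mem_image]
  constructor
  · rintro ⟨⟨r, c⟩, hm, rfl⟩
    have hm' := (mem_addRows_col_succ hcol).mpr ((YoungDiagram.mem_cells _).mp hm)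
    have h1 := SYT_label_le hU hm'
    refine ⟨h1.1, hcard ▸ h1.2, fun s hs he => ?_⟩
    have := (SYT_inj hU ((mem_addRows_col_zero hcol).mpr hs) hm' he).2
    omega
  · rintro ⟨h1, h2, h3⟩
    obtain ⟨r, c, hm, rfl⟩ := SYT_surj hU h1 (hcard ▸ h2)
    rcases c with _ | c
    · exact absurd rfl (h3 r ((mem_addRows_col_zero hcol).mp hm))
    · exact ⟨(r, c), (YoungDiagram.mem_cells _).mpr ((mem_addRows_col_succ hcol).mp hm), rfl⟩

/-- The labels outside the first column are the complement of those in it, so equal first columns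
leave equal label sets, which the common order places identically. -/
theorem eq_of_firstCol_eq (hcol : μ.colLen 0 ≤ m) (hU : U ∈ SYT (addRows μ (col m)))
    (hU' : U' ∈ SYT (addRows μ (col m))) (h0 : ∀ r < m, U r 0 = U' r 0)
    (h : ∀ p ∈ μ.cells, ∀ q ∈ μ.cells, (U p.1 (p.2 + 1) < U q.1 (q.2 + 1) ↔
      U' p.1 (p.2 + 1) < U' q.1 (q.2 + 1))) : U = U' := by
  ext r c
  by_cases hm : (r, c) ∈ addRows μ (col m)
  · rcases c with _ | c
    · exact h0 r ((mem_addRows_col_zero hcol).mp hm)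
    · refine eqOn_of_image_eq (f := fun p : ℕ × ℕ => U p.1 (p.2 + 1))
        (g := fun p => U' p.1 (p.2 + 1)) ?_ h (p := (r, c))
        ((YoungDiagram.mem_cells _).mpr ((mem_addRows_col_succ hcol).mp hm))
      ext a
      rw [mem_image_tail_iff hcol rfl hU, mem_image_tail_iff hcol rfl hU']
      refine and_congr_right fun _ => and_congr_right fun _ => forall_congr' fun r =>
        forall_congr' fun hr => ?_
      rw [h0 r hr]
  · rw [U.zeros hm, U'.zeros hm]

/-- Each label from `1` to `U r 0` lies in the first `r + 1` cells of the first column or in a later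
column. The cell `(r, c + 1)`, whose label is larger, is counted on the right as well; this extra
one gives the strict inequality in `G`. -/
theorem firstCol_le (hcol : μ.colLen 0 ≤ m) (hU : U ∈ SYT (addRows μ (col m))) {r c : ℕ}
    (hm : (r, c) ∈ μ) :
    U r 0 ≤ r + #{q ∈ μ.cells | U q.1 (q.2 + 1) ≤ U r (c + 1)} := by
  have hm' := (mem_addRows_col_succ hcol).mpr hm
  have hr := lt_of_mem hcol hm
  have hlt : U r 0 < U r (c + 1) := hU.2.2 r 0 (c + 1) (Nat.succ_pos c) hm'
  have hle := SYT_label_le hU ((mem_addRows_col_zero hcol).mpr hr)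
  let A := {q ∈ μ.cells | U q.1 (q.2 + 1) ≤ U r 0}
  have hsub : Finset.Icc 1 (U r 0) ⊆ (Finset.range (r + 1)).image (fun s => U s 0) ∪
      A.image (fun q => U q.1 (q.2 + 1)) := by
    intro a ha
    obtain ⟨h1, h2⟩ := Finset.mem_Icc.mp ha
    obtain ⟨s, d, hs, rfl⟩ := SYT_surj hU h1 (h2.trans hle.2)
    rw [Finset.mem_union, Finset.mem_image, Finset.mem_image]
    rcases d with _ | d
    · refine Or.inl ⟨s, Finset.mem_range.mpr ?_, rfl⟩
      by_contra! h0
      have := firstCol_lt (U := U) hcol h0 ((mem_addRows_col_zero hcol).mp hs)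
      omega
    · exact Or.inr ⟨(s, d), Finset.mem_filter.mpr
        ⟨(YoungDiagram.mem_cells _).mpr ((mem_addRows_col_succ hcol).mp hs), h2⟩, rfl⟩
  have h1 := (Finset.card_le_card hsub).trans (Finset.card_union_le _ _)
  have h2 := Finset.card_image_le (s := Finset.range (r + 1)) (f := fun s => U s 0)
  have h3 := Finset.card_image_le (s := A) (f := fun q => U q.1 (q.2 + 1))
  have h4 : #A < #{q ∈ μ.cells | U q.1 (q.2 + 1) ≤ U r (c + 1)} := by
    refine Finset.card_lt_card ⟨Finset.monotone_filter_right _ fun q _ hq => hq.trans hlt.le,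
      fun hs => ?_⟩
    have := (Finset.mem_filter.mp (hs (Finset.mem_filter.mpr
      ⟨(YoungDiagram.mem_cells (r, c)).mpr hm, le_rfl⟩))).2
    exact absurd this (not_le.mpr hlt)
  rw [Nat.card_Icc] at h1
  rw [Finset.card_range] at h2
  omega

theorem exists_corresponds_of_SYT (hcol : μ.colLen 0 ≤ m) (hμ : μ.card = k)
    (hU : U ∈ SYT (addRows μ (col m))) :
    ∃ P ∈ G (row k) μ (m + 1), Corresponds (m + 1) k U P.1 P.2 := by
  have hcard : (addRows μ (col m)).card = k + m := by rw [card_addRows_col hcol, hμ]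
  have hpos {r : ℕ} (hr : r < m) : r + 1 ≤ U r 0 :=
    row_lt_of_mem_SSYT hU.1 ((mem_addRows_col_zero hcol).mpr hr)
  -- Since first-column labels increase by at least one per row, `U r 0 - (r + 1)` is weakly
  -- increasing; comparison with the bottom entry, at most `k + m`, bounds it by `k`.
  have hmono (d : ℕ) : ∀ i, i + d < m → U i 0 + d ≤ U (i + d) 0 := by
    induction d with
    | zero => intro i _; rfl
    | succ d ih =>
      intro i hi
      have h1 := ih i (by omega)
      have h2 := firstCol_lt (U := U) hcol (show i + d < i + (d + 1) by omega) hi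
      omega
  obtain ⟨S, hS, hSU⟩ := exists_row_labelCount (k := k) (m := m) (α := fun r => U r 0 - (r + 1))
    (fun i j hij hj => by
      have h1 := hmono (j - i) i (by omega)
      rw [show i + (j - i) = j by omega] at h1
      omega)
    (fun r hr => by
      have h1 := hmono (m - 1 - r) r (by omega)
      have h2 := SYT_label_le hU ((mem_addRows_col_zero hcol).mpr (show r + (m - 1 - r) < m by omega))
      rw [hcard] at h2
      omega)
  let f (r c : ℕ) : ℕ := U r (c + 1)
  have hfr : ∀ r c c', c < c' → (r, c') ∈ μ → f r c < f r c' := fun r c c' hc hm =>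
    hU.2.2 r (c + 1) (c' + 1) (by omega) ((mem_addRows_col_succ hcol).mpr hm)
  have hfc : ∀ r r' c, r < r' → (r', c) ∈ μ → f r c < f r' c := fun r r' c hr hm =>
    U.col_strict hr ((mem_addRows_col_succ hcol).mpr hm)
  have hT : standardize μ f hfr hfc ∈ SYT μ := by
    refine standardize_mem_SYT hfr hfc ?_
    rintro ⟨r, c⟩ hp ⟨r', c'⟩ hq he
    rw [YoungDiagram.mem_cells] at hp hq
    have := SYT_inj hU ((mem_addRows_col_succ hcol).mpr hp) ((mem_addRows_col_succ hcol).mpr hq) he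
    exact Prod.ext this.1 (by simpa using this.2)
  refine ⟨(S, standardize μ f hfr hfc), (mem_G_row hμ).mpr ⟨hS, hT, fun r c hm => ?_⟩,
    (corresponds_iff hS).mpr ⟨fun r hr => ?_, ?_⟩⟩
  · have h1 := firstCol_le hcol hU hm
    have h2 := hpos (lt_of_mem hcol hm)
    rw [hSU r (lt_of_mem hcol hm), standardize_apply hfr hfc hm]
    simp only [f]
    have h3 : 0 < #{q ∈ μ.cells | U q.1 (q.2 + 1) ≤ U r (c + 1)} :=
      Finset.card_pos.mpr ⟨(r, c), Finset.mem_filter.mpr ⟨(YoungDiagram.mem_cells _).mpr hm, le_rfl⟩⟩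
    omega
  · have := hpos hr
    rw [hSU r hr]
    omega
  · rintro ⟨r, c⟩ hp ⟨r', c'⟩ hq
    rw [YoungDiagram.mem_cells] at hp hq
    exact standardize_lt_iff hfr hfc hp hq

theorem exists_corresponds_of_G (hcol : μ.colLen 0 ≤ m) (hμ : μ.card = k)
    {S : SemistandardYoungTableau (row k)} {T : SemistandardYoungTableau μ}
    (hST : (S, T) ∈ G (row k) μ (m + 1)) :
    ∃ U ∈ SYT (addRows μ (col m)), Corresponds (m + 1) k U S T := by
  obtain ⟨hS, hT, hG⟩ := (mem_G_row hμ).mp hST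
  have hcard : (addRows μ (col m)).card = k + m := by rw [card_addRows_col hcol, hμ]
  let a (r : ℕ) : ℕ := r + 1 + labelCount S (r + 1)
  -- `b t` is the `t`-th positive integer that is not an `a s`: it adds to `t` the number of `a s`
  -- below it, and `a s < b t` means `labelCount S (s + 1) < t`.
  let b (t : ℕ) : ℕ := t + #{s ∈ Finset.range m | labelCount S (s + 1) ≤ t - 1}
  have ha {r r' : ℕ} (h : r < r') : a r < a r' := by
    have := labelCount_mono S (show r + 1 ≤ r' + 1 by omega)
    simp only [a]
    omega
  have hb {t t' : ℕ} (h : t < t') : b t < b t' :=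
    Nat.add_lt_add_of_lt_of_le h (Finset.card_le_card
      (Finset.monotone_filter_right _ fun s _ hs => hs.trans (by omega)))
  have hbound (t : ℕ) : t ≤ b t ∧ b t ≤ t + m :=
    ⟨Nat.le_add_right _ _, Nat.add_le_add_left
      ((Finset.card_filter_le _ _).trans (Finset.card_range m).le) t⟩
  have hab {r t : ℕ} (hr : r < m) (ht : 1 ≤ t) :
      (labelCount S (r + 1) < t → a r < b t) ∧ (¬ labelCount S (r + 1) < t → b t < a r) := by
    have := lt_card_filter_le_iff (f := fun s => labelCount S (s + 1))
      (fun i j hij _ => labelCount_mono S (Nat.succ_le_succ hij)) hr (t - 1)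
    simp only [a, b]
    omega
  let entry (r c : ℕ) : ℕ := if (r, c) ∈ addRows μ (col m) then
    if c = 0 then a r else b (T r (c - 1)) else 0
  have he0 {r : ℕ} (hr : r < m) : entry r 0 = a r := by
    simp only [entry]
    rw [if_pos ((mem_addRows_col_zero hcol).mpr hr), if_pos trivial]
  have he1 {r c : ℕ} (hm : (r, c) ∈ μ) : entry r (c + 1) = b (T r c) := by
    simp only [entry]
    rw [if_pos ((mem_addRows_col_succ hcol).mpr hm), if_neg (by omega), Nat.add_sub_cancel]
  have hrow {r c c' : ℕ} (hc : c < c') (hm : (r, c') ∈ addRows μ (col m)) :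
      entry r c < entry r c' := by
    obtain ⟨d, rfl⟩ : ∃ d, c' = d + 1 := ⟨c' - 1, by omega⟩
    rw [mem_addRows_col_succ hcol] at hm
    rw [he1 hm]
    rcases c with _ | c
    · rw [he0 (lt_of_mem hcol hm)]
      -- The condition of `G` is what places the first column before the rest of its row.
      exact (hab (lt_of_mem hcol hm) (SYT_label_le hT hm).1).1 (hG r d hm)
    · rw [he1 (μ.up_left_mem le_rfl (by omega) hm)]
      exact hb (hT.2.2 r c d (by omega) hm)
  let U : SemistandardYoungTableau (addRows μ (col m)) :=
    { entry := entry
      row_weak' := fun hc hm => (hrow hc hm).le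
      col_strict' := by
        intro r r' c hr hm
        rcases c with _ | c
        · rw [mem_addRows_col_zero hcol] at hm
          rw [he0 hm, he0 (hr.trans hm)]
          exact ha hr
        · rw [mem_addRows_col_succ hcol] at hm
          rw [he1 hm, he1 (μ.up_left_mem hr.le le_rfl hm)]
          exact hb (T.col_strict hr hm)
      zeros' := fun hm => if_neg hm }
  have hU0 {r : ℕ} (hr : r < m) : U r 0 = a r := he0 hr
  have hU1 {r c : ℕ} (hm : (r, c) ∈ μ) : U r (c + 1) = b (T r c) := he1 hm
  have hne {r r' c : ℕ} (hr : r < m) (hm : (r', c) ∈ μ) : a r ≠ b (T r' c) := by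
    have := hab hr (SYT_label_le hT hm).1
    by_cases h : labelCount S (r + 1) < T r' c
    · exact (this.1 h).ne
    · exact (this.2 h).ne'
  refine ⟨U, ⟨?_, ?_, fun r c c' hc hm => hrow hc hm⟩, (corresponds_iff hS).mpr ⟨fun r hr => hU0 hr, ?_⟩⟩
  · rintro ⟨r, c⟩ hm
    rw [YoungDiagram.mem_cells] at hm
    rw [hcard]
    dsimp only
    rcases c with _ | c
    · rw [mem_addRows_col_zero hcol] at hm
      rw [hU0 hm]
      have := labelCount_le S (r + 1)
      simp only [a]
      omega
    · rw [mem_addRows_col_succ hcol] at hm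
      rw [hU1 hm]
      have h1 := hμ ▸ SYT_label_le hT hm
      have h2 := hbound (T r c)
      omega
  · rintro ⟨r, c⟩ hm ⟨r', c'⟩ hm' he
    rw [YoungDiagram.mem_cells] at hm hm'
    dsimp only at he
    rcases c with _ | c <;> rcases c' with _ | c' <;>
      simp only [mem_addRows_col_zero hcol, mem_addRows_col_succ hcol] at hm hm'
    · rw [hU0 hm, hU0 hm'] at he
      rcases lt_trichotomy r r' with h | h | h
      · exact absurd he (ha h).ne
      · rw [h]
      · exact absurd he (ha h).ne'
    · rw [hU0 hm, hU1 hm'] at he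
      exact absurd he (hne hm hm')
    · rw [hU1 hm, hU0 hm'] at he
      exact absurd he.symm (hne hm' hm)
    · rw [hU1 hm, hU1 hm'] at he
      have h := SYT_inj hT hm hm' (by
        rcases lt_trichotomy (T r c) (T r' c') with h | h | h
        · exact absurd he (hb h).ne
        · exact h
        · exact absurd he (hb h).ne')
      rw [h.1, h.2]
  · rintro ⟨r, c⟩ hp ⟨r', c'⟩ hq
    rw [YoungDiagram.mem_cells] at hp hq
    dsimp only
    rw [hU1 hp, hU1 hq]
    refine ⟨fun h => hb h, fun h => ?_⟩
    by_contra! h0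
    rcases h0.lt_or_eq with h1 | h1
    · exact absurd (hb h1) h.asymm
    · rw [h1] at h
      exact h.false

theorem Corresponds.right_unique {S S' : SemistandardYoungTableau (row k)}
    {T T' : SemistandardYoungTableau μ} (hS : S ∈ SSYT (row k) (m + 1)) (hT : T ∈ SYT μ)
    (hS' : S' ∈ SSYT (row k) (m + 1)) (hT' : T' ∈ SYT μ) (h : Corresponds (m + 1) k U S T)
    (h' : Corresponds (m + 1) k U S' T') : (S, T) = (S', T') := by
  rw [corresponds_iff hS] at h
  rw [corresponds_iff hS'] at h'
  refine Prod.ext (row_eq_of_labelCount hS hS' fun r hr => ?_)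
    (SYT_eq_of_order hT hT' fun p hp q hq => (h.2 p hp q hq).trans (h'.2 p hp q hq).symm)
  have h1 := h.1 r hr
  have h2 := h'.1 r hr
  dsimp only
  omega

theorem exists_bijOn_G (hcol : μ.colLen 0 ≤ m) (hμ : μ.card = k) :
    ∃ Φ : SemistandardYoungTableau (addRows μ (col m)) →
        SemistandardYoungTableau (row k) × SemistandardYoungTableau μ,
      (∀ U ∈ SYT (addRows μ (col m)), ∀ S ∈ SSYT (row k) (m + 1), ∀ T ∈ SYT μ,
        (Corresponds (m + 1) k U S T ↔ Φ U = (S, T))) ∧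
      Set.BijOn Φ (SYT (addRows μ (col m))) (G (row k) μ (m + 1)) := by
  classical
  -- `Φ` must be defined on all tableaux; outside the standard ones its value is arbitrary.
  have hex (U : SemistandardYoungTableau (addRows μ (col m))) :
      ∃ P : SemistandardYoungTableau (row k) × SemistandardYoungTableau μ,
        U ∈ SYT (addRows μ (col m)) →
          P ∈ G (row k) μ (m + 1) ∧ Corresponds (m + 1) k U P.1 P.2 := by
    by_cases hU : U ∈ SYT (addRows μ (col m))
    · obtain ⟨P, h1, h2⟩ := exists_corresponds_of_SYT hcol hμ hU
      exact ⟨P, fun _ => ⟨h1, h2⟩⟩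
    · exact ⟨default, fun h => absurd h hU⟩
  choose Φ hΦ using hex
  have hiff : ∀ U ∈ SYT (addRows μ (col m)), ∀ S ∈ SSYT (row k) (m + 1), ∀ T ∈ SYT μ,
      (Corresponds (m + 1) k U S T ↔ Φ U = (S, T)) := by
    intro U hU S hS T hT
    obtain ⟨h1, h2⟩ := hΦ U hU
    constructor
    · intro h
      exact Corresponds.right_unique h1.1 h1.2.1 hS hT h2 h
    · intro h
      rwa [h] at h2
  refine ⟨Φ, hiff, fun U hU => (hΦ U hU).1, fun U hU U' hU' h => ?_, ?_⟩
  · obtain ⟨h1, h2⟩ := hΦ U hU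
    obtain ⟨-, h3⟩ := hΦ U' hU'
    rw [← h, corresponds_iff h1.1] at h3
    rw [corresponds_iff h1.1] at h2
    exact eq_of_firstCol_eq hcol hU hU' (fun r hr => (h2.1 r hr).trans (h3.1 r hr).symm)
      fun p hp q hq => (h2.2 p hp q hq).symm.trans (h3.2 p hp q hq)
  · rintro ⟨S, T⟩ hST
    obtain ⟨U, hU, h⟩ := exists_corresponds_of_G hcol hμ hST
    exact ⟨U, hU, (hiff U hU S hST.1 T hST.2.1).mp h⟩

theorem ncard_G_row (hcol : μ.colLen 0 ≤ m) (hμ : μ.card = k) :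
    (G (row k) μ (m + 1)).ncard = (SYT (addRows μ (col m))).ncard := by
  obtain ⟨Φ, -, h⟩ := exists_bijOn_G hcol hμ
  rw [← h.image_eq, h.injOn.ncard_image]

end Bijection

end Plethysm

theorem corollary3p6 (k n : ℕ) (hk : 0 < k) (hn : 0 < n) (μ : YoungDiagram) (hμ : μ.card = k) :
    (∃ c : YoungDiagram →₀ ℤ,
      Plethysm.IsSchurExpansion n (Plethysm.schurBar n (Plethysm.row k)) c ∧
      (∀ c' : YoungDiagram →₀ ℤ,
        Plethysm.IsSchurExpansion n (Plethysm.schurBar n (Plethysm.row k)) c' → c' = c) ∧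
      c μ = ((Plethysm.G (Plethysm.row k) μ n).ncard : ℤ)) ∧
    (μ.colLen 0 < n →
      ∃ Φ : SemistandardYoungTableau (Plethysm.addRows μ (Plethysm.col (n - 1))) →
          SemistandardYoungTableau (Plethysm.row k) × SemistandardYoungTableau μ,
        (∀ U ∈ Plethysm.SYT (Plethysm.addRows μ (Plethysm.col (n - 1))),
          ∀ S ∈ Plethysm.SSYT (Plethysm.row k) n, ∀ T ∈ Plethysm.SYT μ,
            (Plethysm.Corresponds n k U S T ↔ Φ U = (S, T))) ∧
        Set.BijOn Φ (Plethysm.SYT (Plethysm.addRows μ (Plethysm.col (n - 1))))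
          (Plethysm.G (Plethysm.row k) μ n)) := by
  obtain ⟨m, rfl⟩ : ∃ m, n = m + 1 := ⟨n - 1, by omega⟩
  constructor
  · obtain ⟨c, hc, hcμ⟩ := Plethysm.exists_isSchurExpansion_schurBar_row m k
    refine ⟨c, hc, fun c' hc' => hc'.unique hc, ?_⟩
    rw [hcμ μ hμ]
    split_ifs with h
    · rw [Plethysm.ncard_G_row h hμ]
    · rw [Plethysm.G_eq_empty hμ hn (by omega), Set.ncard_empty, Nat.cast_zero]
  · intro h
    exact Plethysm.exists_bijOn_G (Nat.lt_succ_iff.mp h) hμ
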